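/- Graphs are finite and may have loops and multiple edges. A circuit is a closed walk with at least one edge and no repeated edges (considered up to the choice of starting point and direction). A graph is eulerian if it has an euler circuit, that is, a circuit containing all its edges and all its vertices (equivalently, it is connected and all its degrees are even; a single vertex without edges is also eulerian). A circuit decomposition of $G$ is a collection of circuits of $G$ that together use every edge of $G$ exactly once. The underlying simple graph $\overline{G}$ of $G$ has the same vertices as $G$, with two distinct vertices adjacent if and only if they are joined by an edge of $G$. All embeddings are cellular embeddings in closed surfaces, and a face is identified with the closed walk that bounds it. An embedding is 2-face-colorable if its faces can be colored with two colors so that the two sides of every edge lie on faces of different colors. Let $G$ be an $n$-vertex eulerian graph such that the minimum degree of $\overline{G}$ is at least $(4n+2)/5$, and let $\mathcal{C}$ be a circuit decomposition of $G$. Then $G$ has an orientable embedding with a 2-face-coloring in which the faces of one color are exactly the elements of $\mathcal{C}$, and in which there is exactly one face of the other color if $|V(G)|+|E(G)|+|\mathcal{C}|$ is odd, and there are exactly two faces of the other color if $|V(G)|+|E(G)|+|\mathcal{C}|$ is even. Moreover, this embedding has maximum genus among all orientable embeddings of $G$ in which all elements of $\mathcal{C}$ are faces. -/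

import Mathlib

/-- A graph in half-edge form, with vertex type `V` and half-edge type `H`.  Loops and multiple
edges are allowed. Each half-edge is incident with a vertex, and the half-edges are paired off by a
fixed-point-free involution `mate`. -/
structure HalfEdgeGraph (V H : Type*) where
  inc : H → V
  mate : H → H
  mate_mate : ∀ h, mate (mate h) = h
  mate_ne : ∀ h, mate h ≠ h

namespace HalfEdgeGraph

variable {V H : Type*} (G : HalfEdgeGraph V H)

/-- The involution `mate` as a permutation of the half-edges. -/
def matePerm : Equiv.Perm H := Function.Involutive.toPerm G.mate G.mate_mate

/-- The edge to which a half-edge belongs: the unordered pair `{h, mate h}`. -/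
def edge (h : H) : Sym2 H := s(h, G.mate h)

/-- The edges of the graph: the unordered pairs `{h, mate h}`. -/
abbrev Edge : Type _ := {e : Sym2 H // ∃ h : H, G.edge h = e}

/-- The underlying simple graph: distinct vertices are adjacent iff some edge joins them. -/
def simpleGraph : SimpleGraph V where
  Adj u v := u ≠ v ∧ ∃ h : H, G.inc h = u ∧ G.inc (G.mate h) = v
  symm := ⟨fun u v huv => by
    obtain ⟨hne, h, hu, hv⟩ := huv
    exact ⟨hne.symm, G.mate h, hv, by rw [G.mate_mate]; exact hu⟩⟩
  loopless := ⟨fun _ h => h.1 rfl⟩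

/-- A nontrivial closed walk `v₀ g₁ h₁ v₁ g₂ h₂ … g_ℓ h_ℓ v_ℓ = v₀` (with `h_i = mate g_i`), up to
cyclic shifts, is recorded by the cyclic sequence `(g₁ g₂ … g_ℓ)` of the half-edges through which
it leaves its vertices; the walk must leave each vertex where it arrived. -/
def IsClosedWalk (w : Cycle H) : Prop :=
  w ≠ Cycle.nil ∧ w.Chain fun g g' => G.inc (G.mate g) = G.inc g'

/-- A (nontrivial) circuit: a closed walk without repeated edges. -/
def IsCircuit (w : Cycle H) : Prop :=
  G.IsClosedWalk w ∧ (w.map G.edge).Nodup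

/-- The closed walk traversed in the opposite direction: `(h_ℓ … h₂ h₁)`. -/
def reverseWalk (w : Cycle H) : Cycle H := (w.map G.mate).reverse

/-- A nontrivial euler circuit: a circuit that contains all edges and all vertices. -/
def IsEulerCircuit (w : Cycle H) : Prop :=
  G.IsCircuit w ∧ (∀ h : H, ∃ g ∈ w, G.edge g = G.edge h) ∧ ∀ v : V, ∃ g ∈ w, G.inc g = v

/-- A graph is eulerian if it has an euler circuit.  The second alternative is the edgeless
one-vertex graph, whose euler circuit is the trivial one. -/
def IsEulerian : Prop :=
  (∃ w : Cycle H, G.IsEulerCircuit w) ∨ (Nonempty V ∧ Subsingleton V ∧ IsEmpty H)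

/-- A circuit decomposition: a collection of (nontrivial) circuits that together use every edge
exactly once.  Each circuit is given by one of its two directions of traversal; the two directions
of one circuit share their edges, so they never both belong to the collection. -/
def IsCircuitDecomposition (C : Finset (Cycle H)) : Prop :=
  (∀ w ∈ C, G.IsCircuit w) ∧ ∀ h : H, ∃! w, w ∈ C ∧ ∃ g ∈ w, G.edge g = G.edge h

/-- A cellular embedding of the graph in an oriented surface, given by its rotation system: the
permutation `rot` sends each half-edge to the next one in the rotation at the same vertex, so the
half-edges at each vertex form one cycle of `rot`. -/
structure OrientedEmbedding where
  rot : Equiv.Perm H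
  sameCycle_iff : ∀ g h : H, rot.SameCycle g h ↔ G.inc g = G.inc h

namespace OrientedEmbedding

variable {G} (Φ : G.OrientedEmbedding)

/-- Face tracing: traverse the edge of `g` from `g` to `mate g`, then leave through the half-edge
that follows `mate g` in the rotation. -/
def facePerm : Equiv.Perm H := Φ.rot * G.matePerm

/-- The faces of the embedding: the orbits of the face tracing permutation.  (The underlying graph
is meant to have no isolated vertex.) -/
abbrev Face : Type _ := Quotient (Equiv.Perm.SameCycle.setoid Φ.facePerm)

/-- The face whose traced boundary traverses the edge of `h` starting from `h`.  The two sides of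
that edge lie on `faceOf h` and `faceOf (mate h)`. -/
def faceOf (h : H) : Φ.Face := Quotient.mk _ h

/-- `w` is the facial walk of `f`, in the direction in which the faces are traced. -/
def Traces (f : Φ.Face) (w : Cycle H) : Prop :=
  w.Nodup ∧ (w.Chain fun g g' => Φ.facePerm g = g') ∧ ∀ h : H, h ∈ w ↔ Φ.faceOf h = f

/-- The face `f` is bounded by the closed walk `w`, irrespective of its direction. -/
def IsBoundedBy (f : Φ.Face) (w : Cycle H) : Prop :=
  Φ.Traces f w ∨ Φ.Traces f (G.reverseWalk w)

/-- A proper 2-face-coloring: the two sides of every edge lie on faces of different colors. -/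
def IsTwoFaceColoring (col : Φ.Face → Bool) : Prop :=
  ∀ h : H, col (Φ.faceOf h) ≠ col (Φ.faceOf (G.mate h))

/-- The genus `γ / 2` of the surface, from Euler's formula `|V| - |E| + |F| = 2 - γ` for an
embedding of a connected graph. It is a rational number so that nothing is rounded. -/
noncomputable def genus : ℚ :=
  (2 - ((Nat.card V : ℚ) - (Nat.card G.Edge : ℚ) + (Nat.card Φ.Face : ℚ))) / 2

end OrientedEmbedding

end HalfEdgeGraph

/-! Direct every edge along its circuit in `C`, call the directed edges arcs, and let `σ` send an
arc to the next arc of its circuit. A permutation `κ` of the arcs that fixes initial vertices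
reroutes these walks: the orbits of `κ * σ` are closed walks that together use every arc once. If
the orbits of `κ` are exactly the sets of arcs leaving a common vertex, then the circuits of `C` and
the reversed orbits of `κ * σ` are the faces of an oriented embedding, properly 2-colored by
construction. So the task is to find such a `κ` for which `κ * σ` has one or two orbits. Signs of
permutations make `|V| + |E| + |F|` even in every oriented embedding, and this decides between one
and two. Every embedding in which all circuits of `C` are faces has a further face, so the same
parity gives maximality of the genus.

To find `κ`, only ask at first that it fix initial vertices and that `κ * σ` have a single orbit;
among these take an optimal `κ`, one with fewest orbits. A vertex is split if its arcs meet several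
orbits of `κ`. Two transpositions at pairs that interlace along the single orbit of `κ * σ` again
leave a single orbit. Hence split vertices do not interlace (`IsOptimal.not_interlaced`), and a
split can be moved to an interlacing vertex (`IsOptimal.exists_move`). A similar exchange shows that
a vertex meets at most two orbits of `κ`. Once at most one vertex is known to be split, a single
transposition there joins its two orbits and cuts `κ * σ` into two.

Suppose that `u` and `v` are both split. Their occurrences along `κ * σ` lie in disjoint segments. A
vertex occurring inside both segments has all its occurrences in one gap between `u`'s and one gap
between `v`'s, since otherwise a split moved from `u` to it would interlace with `v`
(`IsOptimal.occurrence`). Let every vertex have at most `q` non-neighbours; the degree bound says `n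
≥ 5q + 7`. Few neighbours of `u` or `v` are missing from their segments, so at least `3q + 3`
vertices lie inside both segments and are adjacent to both `u` and `v`. Each gap contains at most
two of them, one per end, and adjacent ones share a gap, which makes the graph on them too sparse
(`false_of_word`). -/

/-! ### Orbits of a permutation under multiplication by a transposition -/

namespace Equiv.Perm

variable {α : Type*}

/-- The number of orbits of a permutation, fixed points included. -/
noncomputable def orbitCount (f : Perm α) : ℕ := Nat.card (Quotient (SameCycle.setoid f))

theorem SameCycle.of_forall_step [Finite α] {f : Perm α} {r : α → α → Prop} (hr : Equivalence r)
    (h : ∀ a, r a (f a)) {a b : α} (hab : f.SameCycle a b) : r a b := by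
  obtain ⟨n, -, hn⟩ := hab.exists_pow_eq''
  obtain ⟨hn0, rfl⟩ := hn
  clear hn0 hab
  induction n with
  | zero => exact hr.refl a
  | succ n ih => rw [pow_succ', mul_apply]; exact hr.trans ih (h _)

theorem sameCycle_equivalence (f : Perm α) : Equivalence f.SameCycle :=
  ⟨SameCycle.refl f, SameCycle.symm, SameCycle.trans⟩

theorem sameCycle_apply_self (f : Perm α) (a : α) : f.SameCycle a (f a) :=
  sameCycle_apply_right.2 (SameCycle.refl f a)

variable [DecidableEq α] [Finite α] {f : Perm α} {x y : α}

/-- Starting from `x`, the product follows the `f`-orbit of `x` up to its last point `f⁻¹ x`, and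
there the transposition diverts it to `y`. -/
theorem sameCycle_swap_mul_self (h : ¬ f.SameCycle x y) : (swap x y * f).SameCycle x y := by
  by_contra hg
  set g := swap x y * f with hgdef
  have key : ∀ n : ℕ, g.SameCycle x ((f ^ n) x) := by
    intro n
    induction n with
    | zero => exact SameCycle.refl g x
    | succ n ih =>
      rw [pow_succ', mul_apply]
      have hy : f ((f ^ n) x) ≠ y := by
        rintro h'
        exact h ⟨(n + 1 : ℕ), by rw [zpow_natCast, pow_succ', mul_apply, h']⟩
      by_cases hx : f ((f ^ n) x) = x
      · rw [hx]
      · have := ih.trans (sameCycle_apply_self g _)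
        rwa [hgdef, mul_apply, swap_apply_of_ne_of_ne hx hy] at this
  have hs : f.SameCycle x (f⁻¹ x) := ⟨-1, by rw [zpow_neg_one]⟩
  obtain ⟨n, -, -, hn⟩ := hs.exists_pow_eq''
  have := (key n).trans (sameCycle_apply_self g _)
  rw [hn, hgdef, mul_apply, ← mul_apply f, mul_inv_cancel, one_apply,
    swap_apply_left] at this
  exact hg this

/-- Multiplication by a transposition that meets two orbits merges them. -/
theorem sameCycle_swap_mul_iff (h : ¬ f.SameCycle x y) {a b : α} :
    (swap x y * f).SameCycle a b ↔ f.SameCycle a b ∨ (f.SameCycle a x ∧ f.SameCycle b y) ∨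
      (f.SameCycle a y ∧ f.SameCycle b x) := by
  constructor
  · refine SameCycle.of_forall_step
      (r := fun a b => f.SameCycle a b ∨ (f.SameCycle a x ∧ f.SameCycle b y) ∨
      (f.SameCycle a y ∧ f.SameCycle b x)) ⟨fun a => Or.inl (SameCycle.refl f a), ?_, ?_⟩ ?_
    · rintro a b (hab | ⟨h1, h2⟩ | ⟨h1, h2⟩)
      · exact Or.inl hab.symm
      · exact Or.inr (Or.inr ⟨h2, h1⟩)
      · exact Or.inr (Or.inl ⟨h2, h1⟩)
    · rintro a b c (hab | ⟨h1, h2⟩ | ⟨h1, h2⟩) (hbc | ⟨h3, h4⟩ | ⟨h3, h4⟩)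
      · exact Or.inl (hab.trans hbc)
      · exact Or.inr (Or.inl ⟨hab.trans h3, h4⟩)
      · exact Or.inr (Or.inr ⟨hab.trans h3, h4⟩)
      · exact Or.inr (Or.inl ⟨h1, hbc.symm.trans h2⟩)
      · exact absurd (h3.symm.trans h2) h
      · exact Or.inl (h1.trans h4.symm)
      · exact Or.inr (Or.inr ⟨h1, hbc.symm.trans h2⟩)
      · exact Or.inl (h1.trans h4.symm)
      · exact absurd (h2.symm.trans h3) h
    · intro a
      rw [mul_apply]
      have ha := sameCycle_apply_self f a
      by_cases h1 : f a = x
      · rw [h1, swap_apply_left]; rw [h1] at ha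
        exact Or.inr (Or.inl ⟨ha, SameCycle.refl f y⟩)
      by_cases h2 : f a = y
      · rw [h2, swap_apply_right]; rw [h2] at ha
        exact Or.inr (Or.inr ⟨ha, SameCycle.refl f x⟩)
      rw [swap_apply_of_ne_of_ne h1 h2]; exact Or.inl ha
  · have hxy := sameCycle_swap_mul_self h
    have mono : ∀ {a b}, f.SameCycle a b → (swap x y * f).SameCycle a b := by
      intro a b hab
      refine hab.of_forall_step (sameCycle_equivalence _) fun a => ?_
      have ha := sameCycle_apply_self (swap x y * f) a
      rw [mul_apply] at ha
      by_cases h1 : f a = x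
      · rw [h1, swap_apply_left] at ha; rw [h1]; exact ha.trans hxy.symm
      by_cases h2 : f a = y
      · rw [h2, swap_apply_right] at ha; rw [h2]; exact ha.trans hxy
      rwa [swap_apply_of_ne_of_ne h1 h2] at ha
    rintro (hab | ⟨h1, h2⟩ | ⟨h1, h2⟩)
    · exact mono hab
    · exact (mono h1).trans (hxy.trans (mono h2).symm)
    · exact (mono h1).trans (hxy.symm.trans (mono h2).symm)

theorem SameCycle.of_swap_mul (h : f.SameCycle x y) {a b : α}
    (hab : (swap x y * f).SameCycle a b) : f.SameCycle a b := by
  refine hab.of_forall_step (sameCycle_equivalence _) fun a => ?_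
  have ha := sameCycle_apply_self f a
  rw [mul_apply]
  by_cases h1 : f a = x
  · rw [h1, swap_apply_left]; rw [h1] at ha; exact ha.trans h
  by_cases h2 : f a = y
  · rw [h2, swap_apply_right]; rw [h2] at ha; exact ha.trans h.symm
  rwa [swap_apply_of_ne_of_ne h1 h2]

/-- Let `n` be the first time at which `f` takes `x` to `y`. The product runs through `x, f x, …,
f^(n-1) x` and then returns to `x` instead of reaching `y`. -/
theorem SameCycle.not_swap_mul (h : f.SameCycle x y) (hne : x ≠ y) :
    ¬ (swap x y * f).SameCycle x y := by
  classical
  have hex : ∃ n : ℕ, (f ^ n) x = y := by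
    obtain ⟨n, -, -, hn⟩ := h.exists_pow_eq''
    exact ⟨n, hn⟩
  set n := Nat.find hex with hn
  have hny : (f ^ n) x = y := Nat.find_spec hex
  have hmin : ∀ m < n, (f ^ m) x ≠ y := fun m hm => Nat.find_min hex hm
  have hn0 : 0 < n := by
    rcases Nat.eq_zero_or_pos n with h0 | h0
    · rw [h0] at hny; exact absurd hny hne
    · exact h0
  have hret : ∀ j, 0 < j → j ≤ n → (f ^ j) x ≠ x := by
    intro j hj hjn hx
    apply hmin (n - j) (by omega)
    rw [← hny]
    conv_rhs => rw [show n = (n - j) + j by omega, pow_add, mul_apply, hx]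
  have key : ∀ k : ℕ, ∃ i < n, ((swap x y * f) ^ k) x = (f ^ i) x := by
    intro k
    induction k with
    | zero => exact ⟨0, hn0, Eq.refl x⟩
    | succ k ih =>
      obtain ⟨i, hi, hk⟩ := ih
      rw [pow_succ', mul_apply, hk, mul_apply, ← mul_apply f, ← pow_succ']
      rcases Nat.lt_or_ge (i + 1) n with h1 | h1
      · exact ⟨i + 1, h1, swap_apply_of_ne_of_ne (hret _ (by omega) h1.le) (hmin _ h1)⟩
      · have : i + 1 = n := by omega
        rw [this, hny, swap_apply_right]
        exact ⟨0, hn0, Eq.refl x⟩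
  intro hg
  obtain ⟨k, -, -, hk⟩ := hg.exists_pow_eq''
  obtain ⟨i, hi, hik⟩ := key k
  exact hmin i hi (by rw [← hik, hk])

theorem orbitCount_swap_mul (h : ¬ f.SameCycle x y) :
    (swap x y * f).orbitCount + 1 = f.orbitCount := by
  classical
  unfold orbitCount
  let Q := Quotient (SameCycle.setoid f)
  let y' : Q := Quotient.mk _ y
  have hrel : ∀ {a b : α}, (Quotient.mk (SameCycle.setoid f) a = Quotient.mk _ b) ↔
      f.SameCycle a b := Quotient.eq
  have hrel' : ∀ {a b : α}, (Quotient.mk (SameCycle.setoid (swap x y * f)) a = Quotient.mk _ b) ↔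
      (swap x y * f).SameCycle a b := Quotient.eq
  -- The class of `y` is absorbed by that of `x`, so the remaining old orbits represent each new
  -- orbit once.
  let φ : {q : Q // q ≠ y'} → Quotient (SameCycle.setoid (swap x y * f)) := fun q =>
    Quotient.map id (fun a b (hab : f.SameCycle a b) =>
      show (swap x y * f).SameCycle a b from (sameCycle_swap_mul_iff h).2 (Or.inl hab)) q.1
  have hφ : Function.Bijective φ := by
    constructor
    · rintro ⟨a, ha⟩ ⟨b, hb⟩ hab
      induction a using Quotient.inductionOn with | _ a => ?_
      induction b using Quotient.inductionOn with | _ b => ?_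
      have ha' : ¬ f.SameCycle a y := fun h' => ha (hrel.2 h')
      have hb' : ¬ f.SameCycle b y := fun h' => hb (hrel.2 h')
      have := (sameCycle_swap_mul_iff h).1 (hrel'.1 hab)
      apply Subtype.ext
      apply hrel.2
      tauto
    · intro q
      induction q using Quotient.inductionOn with | _ a => ?_
      by_cases ha : f.SameCycle a y
      · refine ⟨⟨Quotient.mk _ x, fun h' => h (hrel.1 h')⟩, ?_⟩
        refine hrel'.2 ?_
        exact (sameCycle_swap_mul_iff h).2 (Or.inr (Or.inl ⟨SameCycle.refl f x, ha⟩))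
      · exact ⟨⟨Quotient.mk _ a, fun h' => ha (hrel.1 h')⟩, rfl⟩
  rw [← Nat.card_eq_of_bijective φ hφ]
  have : Fintype Q := Fintype.ofFinite Q
  rw [Nat.card_eq_fintype_card, Nat.card_eq_fintype_card, Fintype.card_subtype_compl,
    Fintype.card_subtype_eq]
  have : 0 < Fintype.card Q := Fintype.card_pos_iff.2 ⟨y'⟩
  change Fintype.card Q - 1 + 1 = Fintype.card Q
  omega

theorem orbitCount_swap_mul_of_sameCycle (h : f.SameCycle x y) (hne : x ≠ y) :
    (swap x y * f).orbitCount = f.orbitCount + 1 := by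
  have := orbitCount_swap_mul (h.not_swap_mul hne)
  rw [swap_mul_self_mul] at this
  exact this.symm

theorem orbitCount_eq_one_iff {α : Type*} {f : Perm α} : f.orbitCount = 1 ↔ Nonempty α ∧ ∀ a b, f.SameCycle a b := by
  unfold orbitCount
  rw [Nat.card_eq_one_iff_unique]
  constructor
  · rintro ⟨hs, ⟨q⟩⟩
    refine ⟨⟨q.out⟩, fun a b => ?_⟩
    exact Quotient.eq.1 (hs.elim (Quotient.mk (SameCycle.setoid f) a) (Quotient.mk _ b))
  · rintro ⟨⟨a⟩, h⟩
    refine ⟨⟨fun q r => ?_⟩, ⟨Quotient.mk _ a⟩⟩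
    induction q using Quotient.inductionOn with | _ a => ?_
    induction r using Quotient.inductionOn with | _ b => ?_
    exact Quotient.sound (h a b)

/-- A transposition changes both the sign and, by exactly one, the number of orbits. This is the
source of all parity statements about faces. -/
theorem neg_one_pow_orbitCount [Fintype α] (f : Perm α) :
    (-1 : ℤˣ) ^ f.orbitCount = (-1) ^ Fintype.card α * sign f := by
  induction f using swap_induction_on with
  | one =>
    have : (1 : Perm α).orbitCount = Fintype.card α := by
      unfold orbitCount
      rw [← Nat.card_eq_fintype_card]
      symm
      refine Nat.card_eq_of_bijective (Quotient.mk _) ⟨fun a b hab => ?_, Quotient.mk_surjective⟩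
      exact sameCycle_one.1 (Quotient.eq.1 hab)
    rw [this, sign_one, mul_one]
  | swap_mul f x y hne ih =>
    rw [sign_mul, sign_swap hne, mul_left_comm, ← ih]
    by_cases h : f.SameCycle x y
    · rw [orbitCount_swap_mul_of_sameCycle h hne, pow_succ']
    · rw [← orbitCount_swap_mul h, pow_succ', neg_one_mul, neg_one_mul, neg_neg]

end Equiv.Perm

/-! ### Cutting and pasting cyclic orders -/

namespace List


variable {α : Type*} [DecidableEq α]

theorem formPerm_append_cons {x y : α} {a b : List α} (h : (x :: a ++ y :: b).Nodup) :
    formPerm (x :: a ++ y :: b) = Equiv.swap x y * formPerm (x :: a) * formPerm (y :: b) := by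
  induction a generalizing x with
  | nil => simp
  | cons z a ih =>
    have h' : (z :: a ++ y :: b).Nodup := by
      rw [cons_append, nodup_cons] at h; exact h.2
    have hxz : x ≠ z := by rintro rfl; simp at h
    have hxy : x ≠ y := by rintro rfl; simp at h
    have hzy : z ≠ y := by rintro rfl; simp at h
    rw [cons_append, cons_append, formPerm_cons_cons, ← cons_append, ih h', formPerm_cons_cons,
      ← mul_assoc, ← mul_assoc, ← mul_assoc]
    congr 2
    have := Equiv.swap_mul_swap_mul_swap hzy.symm hxy.symm
    rw [← this, mul_assoc (Equiv.swap z x * Equiv.swap y z), Equiv.swap_comm x z, Equiv.swap_mul_self,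
      mul_one, Equiv.swap_comm y z]

theorem swap_mul_formPerm {x y : α} {a b : List α} (h : (x :: a ++ y :: b).Nodup) :
    Equiv.swap x y * formPerm (x :: a ++ y :: b) = formPerm (x :: a) * formPerm (y :: b) := by
  rw [formPerm_append_cons h, mul_assoc, Equiv.swap_mul_self_mul]

end List

namespace Equiv.Perm

variable {α : Type*} [DecidableEq α]

/-- The list `l` enumerates the whole type, in the cyclic order given by the permutation `f`. -/
structure IsCircular (f : Perm α) (l : List α) : Prop where
  nodup : l.Nodup
  mem : ∀ a, a ∈ l
  formPerm_eq : l.formPerm = f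

namespace IsCircular

variable {f : Perm α}

theorem rotate {l l' : List α} (h : f.IsCircular (l ++ l')) : f.IsCircular (l' ++ l) := by
  have hr : (l ++ l').IsRotated (l' ++ l) := List.isRotated_append
  exact ⟨hr.nodup_iff.1 h.nodup, fun a => hr.perm.mem_iff.1 (h.mem a),
    (List.formPerm_eq_of_isRotated h.nodup hr).symm.trans h.formPerm_eq⟩

/-- The first transposition cuts the cyclic word into `x a s b` and `y c t d`. As `s` and `t` lie in
different pieces, the second pastes these together, with the blocks `s b` and `t d` exchanged. -/
theorem swap_swap {x s y t : α} {a b c d : List α}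
    (h : f.IsCircular (x :: a ++ s :: b ++ (y :: c ++ t :: d))) :
    (swap s t * (swap x y * f)).IsCircular (x :: a ++ t :: d ++ (y :: c ++ s :: b)) := by
  have hp : (x :: a ++ s :: b ++ (y :: c ++ t :: d)).Perm
      (s :: b ++ x :: a ++ (t :: d ++ y :: c)) :=
    List.Perm.append List.perm_append_comm List.perm_append_comm
  have hn' := hp.nodup_iff.1 h.nodup
  have h1 : (swap s t * (swap x y * f)).IsCircular (s :: b ++ x :: a ++ (t :: d ++ y :: c)) := by
    refine ⟨hn', fun z => hp.mem_iff.1 (h.mem z), ?_⟩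
    have e1 := List.swap_mul_formPerm (x := x) (y := y) (a := a ++ s :: b) (b := c ++ t :: d)
      (by simpa using h.nodup)
    have e2 := List.formPerm_append_cons (x := s) (y := t) (a := b ++ x :: a) (b := d ++ y :: c)
      (by simpa using hn')
    have hnx := (List.nodup_append.1 h.nodup).1
    have hny := (List.nodup_append.1 h.nodup).2.1
    rw [← h.formPerm_eq]
    have e3 := List.formPerm_eq_of_isRotated hnx List.isRotated_append
    have e4 := List.formPerm_eq_of_isRotated hny List.isRotated_append
    simp only [List.cons_append, List.append_assoc] at e1 e2 e3 e4 ⊢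
    rw [e2, e1, e3, e4, mul_assoc]
  have h2 : (swap s t * (swap x y * f)).IsCircular
      (s :: b ++ (x :: a ++ t :: d ++ y :: c)) := by simpa using h1
  simpa using h2.rotate

/-- The first transposition cuts out the block `y b`, the second reinserts it after `z c`. -/
theorem swap_swap_of_three {x y z : α} {a b c : List α}
    (h : f.IsCircular (x :: a ++ (y :: b ++ z :: c))) :
    (swap x y * (swap y z * f)).IsCircular (x :: a ++ z :: c ++ y :: b) := by
  have hp : (x :: a ++ (y :: b ++ z :: c)).Perm (x :: a ++ z :: c ++ y :: b) := by
    rw [List.append_assoc]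
    exact List.Perm.append_left _ List.perm_append_comm
  have hn' := hp.nodup_iff.1 h.nodup
  refine ⟨hn', fun w => hp.mem_iff.1 (h.mem w), ?_⟩
  have hnr : (z :: c ++ (x :: a ++ y :: b)).Nodup := by
    refine (List.Perm.nodup_iff ?_).1 h.nodup
    rw [← List.append_assoc]; exact List.perm_append_comm
  have h3 := List.formPerm_eq_of_isRotated (l := x :: a ++ (y :: b ++ z :: c))
    (l' := z :: c ++ (x :: a ++ y :: b)) h.nodup
    (by rw [← List.append_assoc]; exact List.isRotated_append)
  rw [← h.formPerm_eq, h3]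
  have e1 := List.swap_mul_formPerm (x := z) (y := y) (a := c ++ x :: a) (b := b)
    (by simpa using hnr)
  have e2 := List.formPerm_append_cons (x := x) (y := y) (a := a ++ z :: c) (b := b)
    (by simpa using hn')
  have e4 := List.formPerm_eq_of_isRotated (l := x :: a ++ z :: c)
    (l' := z :: c ++ x :: a) (List.nodup_append.1 hn').1 List.isRotated_append
  rw [swap_comm y z]
  simp only [List.cons_append, List.append_assoc] at e1 e2 e4 ⊢
  rw [e2, e1, e4, mul_assoc]

theorem sameCycle [Finite α] {l : List α} (h : f.IsCircular l) (a b : α) : f.SameCycle a b := by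
  by_cases hab : a = b
  · rw [hab]
  · have hl : 2 ≤ l.length := by
      have : 1 < l.toFinset.card := Finset.one_lt_card.2
        ⟨a, by simpa using h.mem a, b, by simpa using h.mem b, hab⟩
      rw [List.toFinset_card_of_nodup h.nodup] at this
      exact this
    have hc := List.isCycle_formPerm h.nodup hl
    have hm : ∀ c, l.formPerm c ≠ c := fun c =>
      (List.formPerm_apply_mem_ne_self_iff _ h.nodup c (h.mem c)).2 hl
    rw [← h.formPerm_eq]
    exact hc.sameCycle (hm a) (hm b)

end IsCircular

end Equiv.Perm

namespace Equiv.Perm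

variable {α : Type*} [DecidableEq α]

theorem isCircular_toList [Fintype α] [Nontrivial α] {f : Perm α} (h : ∀ a b, f.SameCycle a b)
    (x : α) : f.IsCircular (f.toList x) := by
  have hx : x ∈ f.support := by
    rw [mem_support]
    intro hx
    obtain ⟨y, hy⟩ := exists_ne x
    obtain ⟨n, hn⟩ := h x y
    rw [zpow_apply_eq_self_of_apply_eq_self hx] at hn
    exact hy hn.symm
  refine ⟨nodup_toList f x, fun a => mem_toList_iff.2 ⟨h x a, hx⟩, ?_⟩
  rw [formPerm_toList]
  ext a
  exact (h x a).cycleOf_apply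

/-- The segment `x (f x) (f² x) …` from position `i` to position `j`. -/
def segment (f : Perm α) (x : α) (i j : ℕ) : List α := (List.range' i (j - i)).map fun k => (f ^ k) x

theorem segment_append {α : Type*} (f : Perm α) (x : α) {i j k : ℕ} (hij : i ≤ j) (hjk : j ≤ k) :
    f.segment x i j ++ f.segment x j k = f.segment x i k := by
  unfold segment
  rw [← List.map_append]
  have := List.range'_append_1 (s := i) (m := j - i) (n := k - j)
  rw [show i + (j - i) = j by omega, show j - i + (k - j) = k - i by omega] at this
  rw [this]

theorem segment_cons {α : Type*} (f : Perm α) (x : α) {i j : ℕ} (hij : i < j) :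
    f.segment x i j = (f ^ i) x :: f.segment x (i + 1) j := by
  unfold segment
  rw [show j - i = (j - (i + 1)) + 1 by omega, List.range'_succ, List.map_cons]

theorem segment_eq {α : Type*} (f : Perm α) (x : α) {i j k : ℕ} (hij : i ≤ j) (hjk : j < k) :
    f.segment x i k = f.segment x i j ++ (f ^ j) x :: f.segment x (j + 1) k := by
  rw [← segment_append f x hij hjk.le, segment_cons f x hjk]

theorem isCircular_segment [Fintype α] [Nontrivial α] {f : Perm α} (h : ∀ a b, f.SameCycle a b)
    (x : α) (i : ℕ) : f.IsCircular (f.segment x i (i + Fintype.card α)) := by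
  have hc := isCircular_toList h ((f ^ i) x)
  have hl : (f.toList ((f ^ i) x)).length = Fintype.card α := by
    rw [← List.toFinset_card_of_nodup hc.nodup, ← Finset.card_univ]
    congr 1
    ext a; simpa using hc.mem a
  have : f.toList ((f ^ i) x) = f.segment x i (i + Fintype.card α) := by
    unfold segment
    apply List.ext_getElem
    · simp [hl]
    · intro n h1 h2
      simp only [getElem_toList, List.getElem_map, List.getElem_range', one_mul]
      rw [add_comm, pow_add, mul_apply]
  rwa [← this]

end Equiv.Perm

/-! ### Optimal transition systems and exchanges -/

namespace TransitionSystem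

open Equiv Equiv.Perm

variable {A V : Type*}

/-- `κ` preserves the fibres of `p`, and `κ * σ` has a single orbit. -/
structure IsUnicursal (p : A → V) (σ κ : Perm A) : Prop where
  comp : ∀ a, p (κ a) = p a
  sameCycle : ∀ a b, (κ * σ).SameCycle a b

/-- `κ` has the fewest orbits among the permutations for which `κ * σ` has a single orbit. -/
structure IsOptimal (p : A → V) (σ κ : Perm A) : Prop extends IsUnicursal p σ κ where
  le : ∀ κ', IsUnicursal p σ κ' → κ.orbitCount ≤ κ'.orbitCount

/-- The fibre at `v` meets several orbits of `κ`. -/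
def IsSplit (p : A → V) (κ : Perm A) (v : V) : Prop :=
  ∃ g h, p g = v ∧ p h = v ∧ ¬ κ.SameCycle g h

variable {p : A → V} {σ κ : Perm A}

theorem apply_eq_of_sameCycle [Finite A] (hκ : ∀ a, p (κ a) = p a) {a b : A}
    (h : κ.SameCycle a b) : p a = p b :=
  h.of_forall_step (r := fun a b => p a = p b)
    ⟨fun _ => Eq.refl _, fun h => h.symm, fun h h' => h.trans h'⟩ fun a => (hκ a).symm

theorem comp_swap_mul [DecidableEq A] (hκ : ∀ a, p (κ a) = p a) {x y : A} (hxy : p x = p y)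
    (a : A) : p ((swap x y * κ) a) = p a := by
  rw [mul_apply]
  by_cases h1 : κ a = x
  · rw [h1, swap_apply_left, ← hxy, ← h1, hκ]
  by_cases h2 : κ a = y
  · rw [h2, swap_apply_right, hxy, ← h2, hκ]
  rw [swap_apply_of_ne_of_ne h1 h2, hκ]

/-- If all pairs of the fibre that `S` separates were in common orbits of `κ`, then `e₁` and `e₂`
would link the whole fibre into one orbit. -/
theorem IsSplit.exists_separated {v : V} (hv : IsSplit p κ v) (S : A → Prop) {e₁ e₂ : A}
    (h₁ : p e₁ = v) (hS₁ : S e₁) (h₂ : p e₂ = v) (hS₂ : ¬ S e₂) :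
    ∃ x y, p x = v ∧ p y = v ∧ S x ∧ ¬ S y ∧ ¬ κ.SameCycle x y := by
  by_contra hcon
  push Not at hcon
  have key : ∀ g, p g = v → κ.SameCycle g e₂ := by
    intro g hg
    by_cases hS : S g
    · exact hcon g e₂ hg h₂ hS hS₂
    · exact (hcon e₁ g h₁ hg hS₁ hS).symm.trans (hcon e₁ e₂ h₁ h₂ hS₁ hS₂)
  obtain ⟨g, h, hg, hh, hgh⟩ := hv
  exact hgh ((key g hg).trans (key h hh).symm)

variable [DecidableEq A]

theorem IsSplit.exists_separated_list {v : V} (hv : IsSplit p κ v) {f : Perm A} {s t : A}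
    {b d : List A} (h : f.IsCircular (s :: b ++ t :: d)) (hs : p s ≠ v) (ht : p t ≠ v)
    {e₁ e₂ : A} (h₁ : p e₁ = v) (hb : e₁ ∈ b) (h₂ : p e₂ = v) (hd : e₂ ∈ d) :
    ∃ x y b₁ b₂ d₁ d₂, p x = v ∧ p y = v ∧ ¬ κ.SameCycle x y ∧ b = b₁ ++ x :: b₂ ∧
      d = d₁ ++ y :: d₂ := by
  have hdis : ∀ z ∈ d, z ∉ b := by
    intro z hz hzb
    have := (List.nodup_append.1 h.nodup).2.2 z (by simp [hzb]) z (by simp [hz])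
    exact this rfl
  obtain ⟨x, y, hx, hy, hxS, hyS, hxy⟩ := hv.exists_separated (· ∈ b) h₁ hb h₂ (hdis _ hd)
  have hyd : y ∈ d := by
    have := h.mem y
    simp only [List.cons_append, List.mem_cons, List.mem_append] at this
    rcases this with rfl | hm | rfl | hm
    · exact absurd hy hs
    · exact absurd hm hyS
    · exact absurd hy ht
    · exact hm
  obtain ⟨b₁, b₂, hb'⟩ := List.append_of_mem hxS
  obtain ⟨d₁, d₂, hd'⟩ := List.append_of_mem hyd
  exact ⟨x, y, b₁, b₂, d₁, d₂, hx, hy, hxy, hb', hd'⟩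

variable [Finite A]

/-- For an optimal `κ`, the fibres at two split vertices do not interlace along `κ * σ`. -/
theorem IsOptimal.not_interlaced (hκ : IsOptimal p σ κ) {u v : V} (huv : u ≠ v)
    (hu : IsSplit p κ u) (hv : IsSplit p κ v) {x s y t : A} {a b c d : List A}
    (h : (κ * σ).IsCircular (x :: a ++ s :: b ++ (y :: c ++ t :: d)))
    (hx : p x = u) (hs : p s = v) (hy : p y = u) (ht : p t = v) : False := by
  have hst : (κ * σ).IsCircular (s :: (b ++ y :: c) ++ t :: (d ++ x :: a)) := by
    have : (κ * σ).IsCircular ((x :: a) ++ (s :: b ++ (y :: c ++ t :: d))) := by simpa using h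
    simpa using this.rotate
  -- The given arcs may share orbits of `κ`. Replace the pair at `u` by one in different orbits that
  -- is still separated by `s` and `t`; then do the same at `v` relative to the new pair at `u`.
  obtain ⟨y', x', b₁, b₂, d₁, d₂, hy', hx', hxy, hb, hd⟩ := hu.exists_separated_list hst
    (by rw [hs]; exact huv.symm) (by rw [ht]; exact huv.symm) hy (by simp) hx (by simp)
  rw [hb, hd] at hst
  have hyx : (κ * σ).IsCircular (y' :: (b₂ ++ t :: d₁) ++ x' :: (d₂ ++ s :: b₁)) := by
    have : (κ * σ).IsCircular ((s :: b₁) ++ (y' :: b₂ ++ (t :: d₁ ++ x' :: d₂))) := by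
      simpa using hst
    simpa using this.rotate
  obtain ⟨t', s', e₁, e₂, f₁, f₂, ht', hs', hst', he, hf⟩ := hv.exists_separated_list hyx
    (by rw [hy']; exact huv) (by rw [hx']; exact huv) ht (by simp) hs (by simp)
  rw [he, hf] at hyx
  have hfin : (κ * σ).IsCircular (y' :: e₁ ++ t' :: e₂ ++ (x' :: f₁ ++ s' :: f₂)) := by
    simpa using hyx
  have hsw := hfin.swap_swap
  have hc₁ := comp_swap_mul hκ.comp (hy'.trans hx'.symm)
  have hc₂ := comp_swap_mul hc₁ (ht'.trans hs'.symm)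
  have hle := hκ.le (swap t' s' * (swap y' x' * κ)) ⟨hc₂, fun a b => by
    simpa only [mul_assoc] using hsw.sameCycle a b⟩
  have h1 := orbitCount_swap_mul hxy
  -- Orbits of `κ` stay within fibres, so merging at `u` leaves the orbits at `v` alone. Both
  -- transpositions therefore merge, against optimality.
  have h2 : ¬ (swap y' x' * κ).SameCycle t' s' := by
    rw [sameCycle_swap_mul_iff hxy]
    rintro (h' | ⟨h', -⟩ | ⟨h', -⟩)
    · exact hst' h'
    · exact huv (hy'.symm.trans ((apply_eq_of_sameCycle hκ.comp h').symm.trans ht'))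
    · exact huv (hx'.symm.trans ((apply_eq_of_sameCycle hκ.comp h').symm.trans ht'))
  have h3 := orbitCount_swap_mul h2
  omega

/-- A split at `u` can be moved to a vertex `w` that is interlaced with `u`. -/
theorem IsOptimal.exists_move (hκ : IsOptimal p σ κ) {u w : V}
    {x s y t : A} {a b c d : List A}
    (h : (κ * σ).IsCircular (x :: a ++ s :: b ++ (y :: c ++ t :: d)))
    (hx : p x = u) (hs : p s = w) (hy : p y = u) (ht : p t = w) (hxy : ¬ κ.SameCycle x y) :
    ∃ κ', IsOptimal p σ κ' ∧ IsSplit p κ' w ∧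
      (∀ v, v ≠ u → IsSplit p κ v → IsSplit p κ' v) ∧
      (κ' * σ).IsCircular (x :: a ++ t :: d ++ (y :: c ++ s :: b)) := by
  have hsw := h.swap_swap
  have hc₁ := comp_swap_mul hκ.comp (hx.trans hy.symm)
  have hc₂ := comp_swap_mul hc₁ (hs.trans ht.symm)
  have huni : IsUnicursal p σ (swap s t * (swap x y * κ)) := ⟨hc₂, fun a b => by
    simpa only [mul_assoc] using hsw.sameCycle a b⟩
  have hle := hκ.le _ huni
  have h1 := orbitCount_swap_mul hxy
  have hst : s ≠ t := by
    rintro rfl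
    have := h.nodup
    simp [List.nodup_append, List.nodup_cons] at this
  -- Otherwise the second transposition would merge as well, against optimality. So it splits the
  -- fibre at `w` and restores the number of orbits.
  have h2 : (swap x y * κ).SameCycle s t := by
    by_contra h2
    have := orbitCount_swap_mul h2
    omega
  have h3 := orbitCount_swap_mul_of_sameCycle h2 hst
  refine ⟨_, ⟨huni, fun κ' h' => ?_⟩, ⟨s, t, hs, ht, h2.not_swap_mul hst⟩, ?_, by
    simpa only [mul_assoc] using hsw⟩
  · have := hκ.le κ' h'
    omega
  · rintro v hvu ⟨g, g', hg, hg', hgg⟩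
    refine ⟨g, g', hg, hg', fun hcon => ?_⟩
    have h4 := (sameCycle_swap_mul_iff hxy).1 (SameCycle.of_swap_mul h2 hcon)
    rcases h4 with h' | ⟨h', -⟩ | ⟨h', -⟩
    · exact hgg h'
    · exact hvu (hg.symm.trans ((apply_eq_of_sameCycle hκ.comp h').trans hx))
    · exact hvu (hg.symm.trans ((apply_eq_of_sameCycle hκ.comp h').trans hy))

/-- Two transpositions would join the three orbits of `κ` into one and merely exchange two blocks of
`κ * σ`, contradicting optimality. -/
theorem IsOptimal.not_three_of_isCircular (hκ : IsOptimal p σ κ) {x y z : A} (hxy : p x = p y)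
    (hyz : p y = p z) (h₁ : ¬ κ.SameCycle x y) (h₂ : ¬ κ.SameCycle y z) (h₃ : ¬ κ.SameCycle x z)
    {a b c : List A} (h : (κ * σ).IsCircular (x :: a ++ (y :: b ++ z :: c))) : False := by
  have hsw := h.swap_swap_of_three
  have hc₁ := comp_swap_mul hκ.comp hyz
  have hc₂ := comp_swap_mul hc₁ hxy
  have hle := hκ.le _ ⟨hc₂, fun a b => by simpa only [mul_assoc] using hsw.sameCycle a b⟩
  have h4 := orbitCount_swap_mul h₂
  have h5 : ¬ (swap y z * κ).SameCycle x y := by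
    rw [sameCycle_swap_mul_iff h₂]
    rintro (h' | ⟨h', -⟩ | ⟨h', -⟩)
    · exact h₁ h'
    · exact h₁ h'
    · exact h₃ h'
  have h6 := orbitCount_swap_mul h5
  omega

/-- For an optimal `κ`, every fibre meets at most two orbits of `κ`. -/
theorem IsOptimal.sameCycle_or (hκ : IsOptimal p σ κ) {x y z : A} (hxy : p x = p y)
    (hyz : p y = p z) (h₁ : ¬ κ.SameCycle x y) : κ.SameCycle z x ∨ κ.SameCycle z y := by
  classical
  by_contra hcon
  push Not at hcon
  have hne : x ≠ y := by rintro rfl; exact h₁ (SameCycle.refl _ _)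
  have hxz : x ≠ z := by rintro rfl; exact hcon.1 (SameCycle.refl _ _)
  have hyz' : y ≠ z := by rintro rfl; exact hcon.2 (SameCycle.refl _ _)
  have : Nontrivial A := ⟨x, y, hne⟩
  have := Fintype.ofFinite A
  have hcirc := isCircular_segment hκ.sameCycle x 0
  rw [segment_cons _ _ (by have := Fintype.card_pos (α := A); omega), pow_zero, one_apply] at hcirc
  set l := (κ * σ).segment x (0 + 1) (0 + Fintype.card A)
  have hy : y ∈ l := by have := hcirc.mem y; simpa [hne.symm] using this
  have hz : z ∈ l := by have := hcirc.mem z; simpa [hxz.symm] using this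
  obtain ⟨l₁, l₂, hl⟩ := List.append_of_mem hy
  rw [hl] at hcirc hz
  have hz' : z ∈ l₁ ∨ z ∈ l₂ := by simpa [hyz'.symm] using hz
  rcases hz' with hz' | hz' <;> obtain ⟨m₁, m₂, hm⟩ := List.append_of_mem hz' <;> subst hm
  · refine hκ.not_three_of_isCircular (hxy.trans hyz) hyz.symm (fun h => hcon.1 h.symm) hcon.2 h₁
      (a := m₁) (b := m₂) (c := l₂) (by simpa using hcirc)
  · exact hκ.not_three_of_isCircular hxy hyz h₁ (fun h => hcon.2 h.symm) (fun h => hcon.1 h.symm)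
      (a := l₁) (b := m₁) (c := m₂) (by simpa using hcirc)

/-- Minimize the number of orbits of `κ * σ`. Two orbits meeting at one vertex could be merged by a
transposition, so each vertex lies on one orbit, and adjacent vertices share it. Any two vertices
have a common neighbour because `2q + 2 < n`. -/
theorem exists_isUnicursal [Fintype V] (S : SimpleGraph V) {q : ℕ}
    (hq : ∀ (a : V) (T : Finset V), (∀ b ∈ T, b ≠ a ∧ ¬ S.Adj a b) → T.card ≤ q)
    (hn : 5 * q + 7 ≤ Fintype.card V)
    (hadj : ∀ u v, S.Adj u v → ∃ a, (p a = u ∧ p (σ a) = v) ∨ (p a = v ∧ p (σ a) = u)) :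
    ∃ κ, IsUnicursal p σ κ := by
  classical
  have hex : ∃ m, ∃ κ : Perm A, (∀ a, p (κ a) = p a) ∧ (κ * σ).orbitCount = m :=
    ⟨_, 1, fun _ => rfl, rfl⟩
  obtain ⟨κ, hκ, hm⟩ := Nat.find_spec hex
  have hmin : ∀ κ' : Perm A, (∀ a, p (κ' a) = p a) → (κ * σ).orbitCount ≤ (κ' * σ).orbitCount :=
    fun κ' h => hm.trans_le (Nat.find_min' hex ⟨κ', h, rfl⟩)
  have hfib : ∀ x y, p x = p y → (κ * σ).SameCycle x y := by
    intro x y hxy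
    by_contra h
    have h1 := orbitCount_swap_mul h
    have h2 := hmin (swap x y * κ) (comp_swap_mul hκ hxy)
    rw [mul_assoc] at h2
    omega
  have hstep : ∀ u v, S.Adj u v → ∀ x y, p x = u → p y = v → (κ * σ).SameCycle x y := by
    have key : ∀ a x y, p x = p a → p y = p (σ a) → (κ * σ).SameCycle x y := by
      intro a x y hx hy
      refine (hfib x a hx).trans ((sameCycle_apply_self _ a).trans (hfib _ y ?_))
      rw [mul_apply, hκ, hy]
    intro u v huv x y hx hy
    obtain ⟨a, ⟨h1, h2⟩ | ⟨h1, h2⟩⟩ := hadj u v huv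
    · exact key a x y (by rw [hx, h1]) (by rw [hy, h2])
    · exact (key a y x (by rw [hy, h1]) (by rw [hx, h2])).symm
  refine ⟨κ, hκ, fun x y => ?_⟩
  obtain ⟨w, hxw, hyw⟩ : ∃ w, S.Adj (p x) w ∧ S.Adj (p y) w := by
    by_contra hcon
    push Not at hcon
    have h1 := hq (p x) (Finset.univ.filter fun w => w ≠ p x ∧ ¬ S.Adj (p x) w)
      fun b hb => (Finset.mem_filter.1 hb).2
    have h2 := hq (p y) (Finset.univ.filter fun w => w ≠ p y ∧ ¬ S.Adj (p y) w)
      fun b hb => (Finset.mem_filter.1 hb).2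
    have hsub : (Finset.univ : Finset V) ⊆ ({p x, p y} ∪
        Finset.univ.filter fun w => w ≠ p x ∧ ¬ S.Adj (p x) w) ∪
        Finset.univ.filter fun w => w ≠ p y ∧ ¬ S.Adj (p y) w := by
      intro w _
      have := hcon w
      simp only [Finset.mem_union, Finset.mem_insert, Finset.mem_singleton, Finset.mem_filter,
        Finset.mem_univ, true_and]
      tauto
    have e1 := Finset.card_le_card hsub
    have e2 := Finset.card_union_le ({p x, p y} ∪
        Finset.univ.filter fun w => w ≠ p x ∧ ¬ S.Adj (p x) w)
        (Finset.univ.filter fun w => w ≠ p y ∧ ¬ S.Adj (p y) w)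
    have e3 := Finset.card_union_le {p x, p y}
        (Finset.univ.filter fun w => w ≠ p x ∧ ¬ S.Adj (p x) w)
    have e4 := Finset.card_le_two (a := p x) (b := p y)
    rw [Finset.card_univ] at e1
    omega
  obtain ⟨a, ha⟩ : ∃ a, p a = w := by
    obtain ⟨a, h | h⟩ := hadj _ _ hxw
    · exact ⟨_, h.2⟩
    · exact ⟨_, h.1⟩
  exact (hstep _ _ hxw x a rfl ha).trans (hstep _ _ hyw y a rfl ha).symm

end TransitionSystem

/-! ### Counting letters of a closed word -/

namespace TransitionSystem

section Words

variable {V : Type*} [DecidableEq V]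

/-- The number of occurrences of the letter `z` in the word `W` before position `k`. -/
def letterCount (W : ℕ → V) (z : V) (k : ℕ) : ℕ := ((Finset.range k).filter fun m => W m = z).card

variable {W : ℕ → V} {z : V}

theorem letterCount_lt {i m k : ℕ} (him : i ≤ m) (hmk : m < k) (hm : W m = z) :
    letterCount W z i < letterCount W z k := by
  apply Finset.card_lt_card
  rw [Finset.ssubset_iff_of_subset]
  · exact ⟨m, by simp [hm, hmk], by simp; omega⟩
  · intro a ha
    simp only [Finset.mem_filter, Finset.mem_range] at ha ⊢
    exact ⟨by omega, ha.2⟩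

theorem letterCount_eq_of_le {i k : ℕ} (hik : i ≤ k) (h : ∀ m, i ≤ m → m < k → W m ≠ z) :
    letterCount W z i = letterCount W z k := by
  unfold letterCount
  congr 1
  ext m
  simp only [Finset.mem_filter, Finset.mem_range]
  constructor
  · rintro ⟨h1, h2⟩; exact ⟨by omega, h2⟩
  · rintro ⟨h1, h2⟩
    refine ⟨?_, h2⟩
    by_contra h3
    exact h m (by omega) h1 h2

theorem letterCount_eq {i k : ℕ} (hi : W i ≠ z) (hk : W k ≠ z)
    (h : ∀ m, (i < m ∧ m < k) ∨ (k < m ∧ m < i) → W m ≠ z) :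
    letterCount W z i = letterCount W z k := by
  rcases le_total i k with hik | hik
  · refine letterCount_eq_of_le hik fun m h1 h2 => ?_
    rcases h1.eq_or_lt with rfl | h1
    · exact hi
    · exact h m (Or.inl ⟨h1, h2⟩)
  · refine (letterCount_eq_of_le hik fun m h1 h2 => ?_).symm
    rcases h1.eq_or_lt with rfl | h1
    · exact hk
    · exact h m (Or.inr ⟨h1, h2⟩)

/-- A position next to a letter `z` is determined by the gap between occurrences of `z` in which
it lies and by the end of that gap at which it lies. -/
theorem eq_of_letterCount_eq {i k : ℕ} (hi : W i ≠ z) (hk : W k ≠ z)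
    (hi' : W (i - 1) = z ∨ W (i + 1) = z) (hk' : W (k - 1) = z ∨ W (k + 1) = z)
    (hside : W (i - 1) = z ↔ W (k - 1) = z)
    (h : letterCount W z i = letterCount W z k) : i = k := by
  have key : ∀ {i k : ℕ}, W k ≠ z → (W (i - 1) = z ∨ W (i + 1) = z) →
      (W (i - 1) = z ↔ W (k - 1) = z) → letterCount W z i = letterCount W z k → ¬ i < k := by
    intro i k hk hi' hside h hlt
    by_cases h1 : W (i - 1) = z
    -- Since `i < k`, the truncated `k - 1` is a true predecessor, and its `z` lies between the two
    -- positions.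
    · exact absurd h (letterCount_lt (by omega) (by omega) (hside.1 h1)).ne
    · have h2 : W (i + 1) = z := by tauto
      have : i + 1 ≠ k := by rintro rfl; exact hk h2
      exact absurd h (letterCount_lt (by omega) (by omega) h2).ne
  have h1 := key hk hi' hside h
  have h2 := key hi hk' hside.symm h.symm
  omega

/-- A family of vertices is small if two functions on it have fibres with at most two elements and
if any two adjacent members agree under one of the functions. -/
theorem false_of_card_ge (S : SimpleGraph V) {q : ℕ}
    (hq : ∀ (a : V) (T : Finset V), (∀ b ∈ T, b ≠ a ∧ ¬ S.Adj a b) → T.card ≤ q)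
    (C : Finset V) (f g : V → ℕ)
    (hf : ∀ a ∈ C, ∀ b ∈ C, ∀ c ∈ C, a ≠ b → a ≠ c → b ≠ c → f a = f b → f a = f c → False)
    (hg : ∀ a ∈ C, ∀ b ∈ C, ∀ c ∈ C, a ≠ b → a ≠ c → b ≠ c → g a = g b → g a = g c → False)
    (hadj : ∀ a ∈ C, ∀ b ∈ C, S.Adj a b → f a = f b ∨ g a = g b)
    (hC : 3 * q + 3 ≤ C.card) : False := by
  classical
  have hfib : ∀ (f : V → ℕ), (∀ a ∈ C, ∀ b ∈ C, ∀ c ∈ C, a ≠ b → a ≠ c → b ≠ c →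
      f a = f b → f a = f c → False) → ∀ c, (C.filter fun w => f w = f c).card ≤ 2 := by
    intro f hf c
    by_contra hcon
    push Not at hcon
    obtain ⟨a, b, d, ha, hb, hd, h1, h2, h3⟩ := Finset.two_lt_card_iff.1 hcon
    rw [Finset.mem_filter] at ha hb hd
    exact hf a ha.1 b hb.1 d hd.1 h1 h2 h3 (ha.2.trans hb.2.symm) (ha.2.trans hd.2.symm)
  obtain ⟨c, hc⟩ : C.Nonempty := Finset.card_pos.1 (by omega)
  set E := C.filter fun w => f w = f c
  set D := C.filter fun w => g w = g c
  have hE : E.card ≤ 2 := hfib f hf c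
  have hD : D.card ≤ 2 := hfib g hg c
  have hED : 1 ≤ (E ∩ D).card := Finset.card_pos.2 ⟨c, by simp [E, D, hc]⟩
  have hun := Finset.card_union_add_card_inter E D
  have hT := hq c (C.filter fun w => w ≠ c ∧ ¬ S.Adj c w) fun b hb => (Finset.mem_filter.1 hb).2
  have hsub : C ⊆ (E ∪ D) ∪ C.filter fun w => w ≠ c ∧ ¬ S.Adj c w := by
    intro w hw
    by_cases h1 : w = c
    · subst h1; simp [E, hw]
    by_cases h2 : S.Adj c w
    · rcases hadj c hc w hw h2 with h | h <;> simp [E, D, hw, h]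
    · simp [hw, h1, h2]
  have hle := (Finset.card_le_card hsub).trans (Finset.card_union_le _ _)
  -- Besides `c`, at most two members agree with `c` under `f` or `g`, and at most `q` are
  -- non-neighbours; so `3q + 3 ≤ q + 3`.
  have hq0 : q = 0 := by omega
  have hclique : ∀ a b, a ≠ b → S.Adj a b := by
    intro a b hab
    by_contra h
    have := hq a {b} (by simpa using ⟨hab.symm, h⟩)
    simp [hq0] at this
  -- In a triangle, two of the three pairs agree under the same function, so that function is
  -- constant on all three vertices.
  obtain ⟨a, b, d, ha, hb, hd, h1, h2, h3⟩ := Finset.two_lt_card_iff.1 (show 2 < C.card by omega)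
  rcases hadj a ha b hb (hclique a b h1) with hab | hab <;>
    rcases hadj a ha d hd (hclique a d h2) with had | had <;>
    rcases hadj b hb d hd (hclique b d h3) with hbd | hbd
  · exact hf a ha b hb d hd h1 h2 h3 hab had
  · exact hf a ha b hb d hd h1 h2 h3 hab had
  · exact hf a ha b hb d hd h1 h2 h3 hab (hab.trans hbd)
  · exact hg a ha b hb d hd h1 h2 h3 (had.trans hbd.symm) had
  · exact hf a ha b hb d hd h1 h2 h3 (had.trans hbd.symm) had
  · exact hg a ha b hb d hd h1 h2 h3 hab (hab.trans hbd)
  · exact hg a ha b hb d hd h1 h2 h3 hab had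
  · exact hg a ha b hb d hd h1 h2 h3 hab had

/-- There is no closed word that traverses all edges of a dense graph, in which the occurrences
of two letters `u` and `v` are confined to disjoint segments and every letter that occurs within
both segments only occurs in one gap of each. -/
theorem false_of_word [Fintype V] (S : SimpleGraph V) {q N α β γ : ℕ} {u v : V} (huv : u ≠ v)
    (hq : ∀ (a : V) (T : Finset V), (∀ b ∈ T, b ≠ a ∧ ¬ S.Adj a b) → T.card ≤ q)
    (hn : 5 * q + 7 ≤ Fintype.card V)
    (hadj : ∀ a b, S.Adj a b →
      ∃ k < N, (W k = a ∧ W (k + 1) = b) ∨ (W k = b ∧ W (k + 1) = a))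
    (hαβ : α < β) (hβγ : β ≤ γ) (hγN : γ < N) (hWN : W N = u) (hW0 : W 0 = u) (hWα : W α = u) (hWβ : W β = v)
    (hWγ : W γ = v) (hu : ∀ k < N, W k = u → k ≤ α) (hv : ∀ k < N, W k = v → β ≤ k ∧ k ≤ γ)
    (hw : ∀ w, w ≠ u → w ≠ v → ∀ i j k, 0 < i → i < α → β < j → j < γ → k < N →
      W i = w → W j = w → W k = w →
      (k < α ∧ ∀ m, (i < m ∧ m < k) ∨ (k < m ∧ m < i) → W m ≠ u) ∨
      (β < k ∧ k < γ ∧ ∀ m, (j < m ∧ m < k) ∨ (k < m ∧ m < j) → W m ≠ v)) : False := by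
  classical
  let I : V → Prop := fun w => ∃ i, 0 < i ∧ i < α ∧ W i = w
  let J : V → Prop := fun w => ∃ j, β < j ∧ j < γ ∧ W j = w
  set A := Finset.univ.filter fun w => w ≠ u ∧ w ≠ v ∧ ¬ J w with hA
  set B := Finset.univ.filter fun w => w ≠ u ∧ w ≠ v ∧ J w ∧ ¬ I w with hB
  set C := Finset.univ.filter fun w => w ≠ u ∧ w ≠ v ∧ J w ∧ I w with hC
  have hcard : Fintype.card V ≤ 2 + A.card + B.card + C.card := by
    have hsub : (Finset.univ : Finset V) ⊆ (({u, v} ∪ A) ∪ B) ∪ C := by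
      intro w _
      by_cases h1 : w = u
      · simp [h1]
      by_cases h2 : w = v
      · simp [h2]
      by_cases h3 : J w <;> by_cases h4 : I w <;> simp [hA, hB, hC, h1, h2, h3, h4]
    have e1 := Finset.card_le_card hsub
    have e2 := Finset.card_union_le (({u, v} ∪ A) ∪ B) C
    have e3 := Finset.card_union_le ({u, v} ∪ A) B
    have e4 := Finset.card_union_le {u, v} A
    have e5 := Finset.card_pair huv
    rw [Finset.card_univ] at e1
    omega
  -- With at most two neighbours in `X ∪ {y}`, the vertex `z` has at least `|X| - 1` non-neighbours
  -- there. Those in `C` come on top, and the total is at most `q`.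
  have hfar : ∀ (z y : V) (X : Finset V), y ∉ X → z ≠ y → z ∉ X → z ∉ C → y ∉ C →
      Disjoint X C → ∀ p₁ p₂ : V, (∀ w ∈ insert y X, S.Adj z w → w = p₁ ∨ w = p₂) →
      X.card + (C.filter fun w => ¬ S.Adj z w).card ≤ q + 1 := by
    intro z y X hyX hzy hzX hzC hyC hXC p₁ p₂ hp
    have h1 : ((insert y X).filter fun w => S.Adj z w).card ≤ 2 := by
      refine (Finset.card_le_card (t := {p₁, p₂}) fun w hw' => ?_).trans Finset.card_le_two
      rw [Finset.mem_filter] at hw'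
      simpa using hp w hw'.1 hw'.2
    have h2 := Finset.card_filter_add_card_filter_not (s := insert y X) fun w => S.Adj z w
    rw [Finset.card_insert_of_notMem hyX] at h2
    have h3 : Disjoint ((insert y X).filter fun w => ¬ S.Adj z w)
        (C.filter fun w => ¬ S.Adj z w) :=
      Finset.disjoint_filter_filter (Finset.disjoint_insert_left.2 ⟨hyC, hXC⟩)
    have h4 := hq z (((insert y X).filter fun w => ¬ S.Adj z w) ∪ C.filter fun w => ¬ S.Adj z w)
      (by
        intro b hb
        rw [Finset.mem_union, Finset.mem_filter, Finset.mem_filter, Finset.mem_insert] at hb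
        refine ⟨?_, by tauto⟩
        rintro rfl
        tauto)
    rw [Finset.card_union_of_disjoint h3] at h4
    omega
  -- Neither `u` nor a letter of `A` occurs strictly between `β` and `γ`, so it can follow or
  -- precede a `v` only at the outer ends of the segment.
  have hvA := hfar v u A (by simp [hA]) huv.symm (by simp [hA]) (by simp [hC]) (by simp [hC])
    (by
      rw [Finset.disjoint_left]
      intro w h1 h2
      simp only [hA, hC, Finset.mem_filter] at h1 h2
      exact h1.2.2.2 h2.2.2.2.1) (W (β - 1)) (W (γ + 1)) (by
      intro w hwA hvw
      have hwv : w ≠ v := hvw.ne'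
      have hwJ : ∀ k, β < k → k < γ → W k ≠ w := by
        intro k h1 h2 h3
        rw [Finset.mem_insert] at hwA
        rcases hwA with rfl | hwA
        · have := hu k (by omega) h3; omega
        · simp only [hA, Finset.mem_filter] at hwA
          exact hwA.2.2.2 ⟨k, h1, h2, h3⟩
      obtain ⟨k, hk, ⟨h1, h2⟩ | ⟨h1, h2⟩⟩ := hadj v w hvw
      · have h3 := hv k hk h1
        by_cases hkγ : k = γ
        · right; rw [← h2, hkγ]
        · exfalso
          by_cases h4 : k + 1 = γ
          · rw [h4, hWγ] at h2; exact hwv h2.symm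
          · exact hwJ (k + 1) (by omega) (by omega) h2
      · have hk1 : k + 1 < N := by
          by_contra h
          have : k + 1 = N := by omega
          rw [this, hWN] at h2
          exact huv h2
        have h3 := hv (k + 1) hk1 h2
        by_cases hkβ : k + 1 = β
        · left; rw [← h1, ← hkβ, Nat.add_sub_cancel]
        · exfalso
          by_cases h4 : k = β
          · rw [h4, hWβ] at h1; exact hwv h1.symm
          · exact hwJ k (by omega) (by omega) h1)
  -- The same for the segment from `0` to `α`; the position before `0` is `N - 1`, cyclically.
  have huB := hfar u v B (by simp [hB]) huv (by simp [hB]) (by simp [hC]) (by simp [hC])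
    (by
      rw [Finset.disjoint_left]
      intro w h1 h2
      simp only [hB, hC, Finset.mem_filter] at h1 h2
      exact h1.2.2.2.2 h2.2.2.2.2) (W (α + 1)) (W (N - 1)) (by
      intro w hwB huw
      have hwu : w ≠ u := huw.ne'
      have hwI : ∀ k, 0 < k → k < α → W k ≠ w := by
        intro k h1 h2 h3
        rw [Finset.mem_insert] at hwB
        rcases hwB with rfl | hwB
        · have := hv k (by omega) h3; omega
        · simp only [hB, Finset.mem_filter] at hwB
          exact hwB.2.2.2.2 ⟨k, h1, h2, h3⟩
      obtain ⟨k, hk, ⟨h1, h2⟩ | ⟨h1, h2⟩⟩ := hadj u w huw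
      · have h3 := hu k hk h1
        by_cases hkα : k = α
        · left; rw [← h2, hkα]
        · exfalso
          by_cases h4 : k + 1 = α
          · rw [h4, hWα] at h2; exact hwu h2.symm
          · exact hwI (k + 1) (by omega) (by omega) h2
      · by_cases hk1 : k + 1 = N
        · right; rw [← h1, ← hk1, Nat.add_sub_cancel]
        · exfalso
          have h3 := hu (k + 1) (by omega) h2
          by_cases h4 : k = 0
          · rw [h4, hW0] at h1; exact hwu h1.symm
          · exact hwI k (by omega) (by omega) h1)
  -- `hcard`, `hvA` and `huB` give `|D| ≥ n - 2 - 2(q + 1) ≥ 3q + 3`.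
  set D := C.filter fun w => S.Adj u w ∧ S.Adj v w with hD
  have hCD : C.card ≤ D.card + (C.filter fun w => ¬ S.Adj v w).card +
      (C.filter fun w => ¬ S.Adj u w).card := by
    have hsub : C ⊆ (D ∪ C.filter fun w => ¬ S.Adj v w) ∪ C.filter fun w => ¬ S.Adj u w := by
      intro w hwC
      by_cases h1 : S.Adj u w <;> by_cases h2 : S.Adj v w <;> simp [hD, hwC, h1, h2]
    have e1 := Finset.card_le_card hsub
    have e2 := Finset.card_union_le (D ∪ C.filter fun w => ¬ S.Adj v w)
      (C.filter fun w => ¬ S.Adj u w)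
    have e3 := Finset.card_union_le D (C.filter fun w => ¬ S.Adj v w)
    omega
  have hDmem : ∀ w ∈ D, w ≠ u ∧ w ≠ v ∧ J w ∧ I w ∧ S.Adj u w ∧ S.Adj v w := by
    intro w hwD
    simp only [hD, hC, Finset.mem_filter, Finset.mem_univ, true_and] at hwD
    tauto
  -- An edge from `u` to `w` puts some `w` next to a `u`, and `hw` confines this occurrence to the
  -- inside of the segment of `u`.
  have hi : ∀ w ∈ D, ∃ i, 0 < i ∧ i < α ∧ W i = w ∧ (W (i - 1) = u ∨ W (i + 1) = u) := by
    intro w hwD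
    obtain ⟨hwu, hwv, ⟨j, hj1, hj2, hj3⟩, ⟨i, hi1, hi2, hi3⟩, huw, -⟩ := hDmem w hwD
    obtain ⟨k, hk, ⟨h1, h2⟩ | ⟨h1, h2⟩⟩ := hadj u w huw
    · have hk1 : k + 1 < N := by
        by_contra h
        have : k + 1 = N := by omega
        rw [this, hWN] at h2
        exact hwu h2.symm
      have h3 := hu k hk h1
      refine ⟨k + 1, by omega, ?_, h2, Or.inl (by simpa using h1)⟩
      rcases hw w hwu hwv i j (k + 1) hi1 hi2 hj1 hj2 hk1 hi3 hj3 h2 with h | h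
      · exact h.1
      · omega
    · have hk0 : k ≠ 0 := by rintro rfl; exact hwu (h1.symm.trans hW0)
      refine ⟨k, by omega, ?_, h1, Or.inr h2⟩
      rcases hw w hwu hwv i j k hi1 hi2 hj1 hj2 hk hi3 hj3 h1 with h | h
      · exact h.1
      · have := hu (k + 1) (by omega) h2
        omega
  have hj : ∀ w ∈ D, ∃ j, β < j ∧ j < γ ∧ W j = w ∧ (W (j - 1) = v ∨ W (j + 1) = v) := by
    intro w hwD
    obtain ⟨hwu, hwv, ⟨j, hj1, hj2, hj3⟩, ⟨i, hi1, hi2, hi3⟩, -, hvw⟩ := hDmem w hwD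
    obtain ⟨k, hk, ⟨h1, h2⟩ | ⟨h1, h2⟩⟩ := hadj v w hvw
    · have hk1 : k + 1 < N := by
        by_contra h
        have : k + 1 = N := by omega
        have h3 := hv k hk h1
        rw [this, hWN] at h2
        exact hwu h2.symm
      have h3 := hv k hk h1
      rcases hw w hwu hwv i j (k + 1) hi1 hi2 hj1 hj2 hk1 hi3 hj3 h2 with h | h
      · omega
      · exact ⟨k + 1, h.1, h.2.1, h2, Or.inl (by simpa using h1)⟩
    · have hk1 : k + 1 < N := by
        by_contra h
        have : k + 1 = N := by omega
        rw [this, hWN] at h2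
        exact huv h2
      have h3 := hv (k + 1) hk1 h2
      rcases hw w hwu hwv i j k hi1 hi2 hj1 hj2 hk hi3 hj3 h1 with h | h
      · omega
      · exact ⟨k, h.1, h.2.1, h1, Or.inr h2⟩
  choose! i hi1 hi2 hi3 hi4 using hi
  choose! j hj1 hj2 hj3 hj4 using hj
  -- A gap has only two ends, so of three members with the same `letterCount` two would occupy the
  -- same position.
  have hgap : ∀ (z : V) (i : V → ℕ), (∀ w ∈ D, w ≠ z) →
      (∀ w ∈ D, W (i w) = w) → (∀ w ∈ D, W (i w - 1) = z ∨ W (i w + 1) = z) →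
      ∀ a ∈ D, ∀ b ∈ D, ∀ c ∈ D, a ≠ b → a ≠ c → b ≠ c →
        letterCount W z (i a) = letterCount W z (i b) →
        letterCount W z (i a) = letterCount W z (i c) → False := by
    intro z i hz hW hend a ha b hb c hc hab hac hbc h1 h2
    have inj : ∀ a ∈ D, ∀ b ∈ D, a ≠ b → letterCount W z (i a) = letterCount W z (i b) →
        ¬ (W (i a - 1) = z ↔ W (i b - 1) = z) := by
      intro a ha b hb hab hl hs
      have := eq_of_letterCount_eq (by rw [hW a ha]; exact hz a ha)
        (by rw [hW b hb]; exact hz b hb) (hend a ha) (hend b hb) hs hl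
      exact hab (by rw [← hW a ha, ← hW b hb, this])
    have i1 := inj a ha b hb hab h1
    have i2 := inj a ha c hc hac h2
    have i3 := inj b hb c hc hbc (h1.symm.trans h2)
    tauto
  refine false_of_card_ge S hq D (fun w => letterCount W u (i w)) (fun w => letterCount W v (j w))
    (hgap u i (fun w h => (hDmem w h).1) hi3 hi4)
    (hgap v j (fun w h => (hDmem w h).2.1) hj3 hj4)
    ?_ (by omega)
  have hloc : ∀ w ∈ D, ∀ k < N, W k = w →
      (k < α ∧ letterCount W u (i w) = letterCount W u k) ∨
      (β < k ∧ k < γ ∧ letterCount W v (j w) = letterCount W v k) := by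
    intro w hwD k hk hkw
    have hm := hDmem w hwD
    rcases hw w hm.1 hm.2.1 (i w) (j w) k (hi1 w hwD) (hi2 w hwD) (hj1 w hwD) (hj2 w hwD) hk
      (hi3 w hwD) (hj3 w hwD) hkw with h | h
    · exact Or.inl ⟨h.1, letterCount_eq (by rw [hi3 w hwD]; exact hm.1) (by rw [hkw]; exact hm.1)
        h.2⟩
    · exact Or.inr ⟨h.1, h.2.1, letterCount_eq (by rw [hj3 w hwD]; exact hm.2.1)
        (by rw [hkw]; exact hm.2.1) h.2.2⟩
  -- An edge between members is traversed at consecutive positions, neither of which is a `u` or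
  -- `v`, so both lie in the same gap.
  have hstep : ∀ a ∈ D, ∀ b ∈ D, ∀ k < N, W k = a → W (k + 1) = b →
      letterCount W u (i a) = letterCount W u (i b) ∨
      letterCount W v (j a) = letterCount W v (j b) := by
    intro a ha b hb k hk hka hkb
    have hma := hDmem a ha
    have hmb := hDmem b hb
    have hk1 : k + 1 < N := by
      by_contra h
      have : k + 1 = N := by omega
      rw [this, hWN] at hkb
      exact hmb.1 hkb.symm
    have hne : ∀ z : V, a ≠ z → letterCount W z k = letterCount W z (k + 1) := fun z hz =>
      letterCount_eq_of_le (by omega) fun m h1 h2 => by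
        have : m = k := by omega
        rw [this, hka]; exact hz
    rcases hloc a ha k hk hka with h1 | h1 <;> rcases hloc b hb (k + 1) hk1 hkb with h2 | h2
    · exact Or.inl (by rw [h1.2, h2.2, hne u hma.1])
    · omega
    · omega
    · exact Or.inr (by rw [h1.2.2, h2.2.2, hne v hma.2.1])
  intro a ha b hb hab
  obtain ⟨k, hk, ⟨h1, h2⟩ | ⟨h1, h2⟩⟩ := hadj a b hab
  · exact hstep a ha b hb k hk h1 h2
  · exact (hstep b hb a ha k hk h1 h2).imp Eq.symm Eq.symm

end Words

end TransitionSystem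

/-! ### Positions along a single orbit, and uniqueness of the split vertex -/

namespace Equiv.Perm

variable {α : Type*} [DecidableEq α] [Fintype α] [Nontrivial α] {f : Perm α}

theorem pow_card_of_sameCycle (h : ∀ a b, f.SameCycle a b) : f ^ Fintype.card α = 1 := by
  obtain ⟨x⟩ : Nonempty α := inferInstance
  have hc := isCircular_segment h x 0
  have := List.formPerm_pow_length_eq_one_of_nodup _ hc.nodup
  rw [hc.formPerm_eq] at this
  simpa [segment] using this

theorem exists_pow_lt_of_sameCycle (h : ∀ a b, f.SameCycle a b) (x a : α) :
    ∃ k < Fintype.card α, (f ^ k) x = a := by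
  have := (isCircular_segment h x 0).mem a
  simpa [segment] using this

theorem pow_injective_of_sameCycle (h : ∀ a b, f.SameCycle a b) (x : α) {i j : ℕ}
    (hi : i < Fintype.card α) (hj : j < Fintype.card α) (hij : (f ^ i) x = (f ^ j) x) : i = j := by
  have := List.inj_on_of_nodup_map (isCircular_segment h x 0).nodup
    (x := i) (y := j)
  exact this (by simpa using hi) (by simpa using hj) hij

theorem isCircular_of_lt (h : ∀ a b, f.SameCycle a b) (x : α) {i j k l : ℕ} (hij : i < j)
    (hjk : j < k) (hkl : k < l) (hl : l < i + Fintype.card α) :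
    f.IsCircular ((f ^ i) x :: f.segment x (i + 1) j ++ (f ^ j) x :: f.segment x (j + 1) k ++
      ((f ^ k) x :: f.segment x (k + 1) l ++
        (f ^ l) x :: f.segment x (l + 1) (i + Fintype.card α))) := by
  have := isCircular_segment h x i
  rwa [← segment_append f x (show i ≤ k by omega) (show k ≤ i + Fintype.card α by omega),
    ← segment_append f x (show i ≤ j by omega) hjk.le,
    ← segment_append f x hkl.le hl.le, segment_cons f x hij, segment_cons f x hjk,
    segment_cons f x hkl, segment_cons f x hl] at this

end Equiv.Perm

namespace TransitionSystem

open Equiv Equiv.Perm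

variable {A V : Type*} [DecidableEq A] [Fintype A] [Nontrivial A] {p : A → V} {σ κ : Perm A}

theorem IsOptimal.not_interlaced_pow (hκ : IsOptimal p σ κ) {u v : V} (huv : u ≠ v)
    (hu : IsSplit p κ u) (hv : IsSplit p κ v) (z : A) {i j k l : ℕ} (hij : i < j)
    (hjk : j < k) (hkl : k < l) (hl : l < i + Fintype.card A)
    (hi' : p (((κ * σ) ^ i) z) = u) (hj' : p (((κ * σ) ^ j) z) = v)
    (hk' : p (((κ * σ) ^ k) z) = u) (hl' : p (((κ * σ) ^ l) z) = v) : False :=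
  hκ.not_interlaced huv hu hv (isCircular_of_lt hκ.sameCycle z hij hjk hkl hl) hi' hj' hk' hl'

/-- The vertices appear in the order `u w u w v w v`. Moving the split from `u` to `w` keeps the
stretch from `j` on intact, and there `w v w v` interlaces two split vertices. -/
theorem IsOptimal.false_of_move_left (hκ : IsOptimal p σ κ) {u v w : V} (hvu : v ≠ u)
    (hwv : w ≠ v) (hv : IsSplit p κ v) (z : A) {x i y j s k t : ℕ}
    (hxi : x < i) (hiy : i < y) (hyj : y < j) (hjs : j < s) (hsk : s < k) (hkt : k < t)
    (ht : t < x + Fintype.card A)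
    (hx' : p (((κ * σ) ^ x) z) = u) (hi' : p (((κ * σ) ^ i) z) = w)
    (hy' : p (((κ * σ) ^ y) z) = u) (hj' : p (((κ * σ) ^ j) z) = w)
    (hs' : p (((κ * σ) ^ s) z) = v) (hk' : p (((κ * σ) ^ k) z) = w)
    (ht' : p (((κ * σ) ^ t) z) = v)
    (hxy : ¬ κ.SameCycle (((κ * σ) ^ x) z) (((κ * σ) ^ y) z)) : False := by
  obtain ⟨κ', hκ', hw, hall, hc⟩ := hκ.exists_move
    (isCircular_of_lt hκ.sameCycle z hxi hiy hyj (show j < x + Fintype.card A by omega))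
    hx' hi' hy' hj' hxy
  rw [segment_eq (κ * σ) z (show j + 1 ≤ s by omega) (show s < x + Fintype.card A by omega),
    segment_eq (κ * σ) z (show s + 1 ≤ k by omega) (show k < x + Fintype.card A by omega),
    segment_eq (κ * σ) z (show k + 1 ≤ t by omega) (show t < x + Fintype.card A by omega)] at hc
  simp only [List.append_assoc] at hc
  have hc := hc.rotate
  refine hκ'.not_interlaced hwv hw (hall v hvu hv) (a := (κ * σ).segment z (j + 1) s)
    (b := (κ * σ).segment z (s + 1) k) (c := (κ * σ).segment z (k + 1) t)
    (d := (κ * σ).segment z (t + 1) (x + Fintype.card A) ++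
      ((κ * σ) ^ y) z :: ((κ * σ).segment z (y + 1) j ++
      ((κ * σ) ^ i) z :: ((κ * σ).segment z (i + 1) y ++
      ((κ * σ) ^ x) z :: ((κ * σ).segment z (x + 1) i)))) ?_
    hj' hs' hk' ht'
  simpa using hc

/-- The order is `u w u v w v w`. After the move the stretch from `j` on is followed by the one from
`y`, so the positions `j, t, k, s` read `w v w v`. -/
theorem IsOptimal.false_of_move_right (hκ : IsOptimal p σ κ) {u v w : V} (hvu : v ≠ u)
    (hwv : w ≠ v) (hv : IsSplit p κ v) (z : A) {x i y s j t k : ℕ}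
    (hxi : x < i) (hiy : i < y) (hys : y < s) (hsj : s < j) (hjt : j < t) (htk : t < k)
    (hk : k < x + Fintype.card A)
    (hx' : p (((κ * σ) ^ x) z) = u) (hi' : p (((κ * σ) ^ i) z) = w)
    (hy' : p (((κ * σ) ^ y) z) = u) (hs' : p (((κ * σ) ^ s) z) = v)
    (hj' : p (((κ * σ) ^ j) z) = w) (ht' : p (((κ * σ) ^ t) z) = v)
    (hk' : p (((κ * σ) ^ k) z) = w)
    (hxy : ¬ κ.SameCycle (((κ * σ) ^ x) z) (((κ * σ) ^ y) z)) : False := by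
  obtain ⟨κ', hκ', hw, hall, hc⟩ := hκ.exists_move
    (isCircular_of_lt hκ.sameCycle z hxi hiy (show y < j by omega)
      (show j < x + Fintype.card A by omega)) hx' hi' hy' hj' hxy
  rw [segment_eq (κ * σ) z (show j + 1 ≤ t by omega) (show t < x + Fintype.card A by omega),
    segment_eq (κ * σ) z (show t + 1 ≤ k by omega) (show k < x + Fintype.card A by omega),
    segment_eq (κ * σ) z (show y + 1 ≤ s by omega) (show s < j by omega)] at hc
  simp only [List.append_assoc] at hc
  have hc := hc.rotate
  refine hκ'.not_interlaced hwv hw (hall v hvu hv) (a := (κ * σ).segment z (j + 1) t)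
    (b := (κ * σ).segment z (t + 1) k)
    (c := (κ * σ).segment z (k + 1) (x + Fintype.card A) ++
      ((κ * σ) ^ y) z :: (κ * σ).segment z (y + 1) s)
    (d := (κ * σ).segment z (s + 1) j ++ ((κ * σ) ^ i) z :: ((κ * σ).segment z (i + 1) y ++
      ((κ * σ) ^ x) z :: ((κ * σ).segment z (x + 1) i))) ?_
    hj' ht' hk' hs'
  simpa using hc

theorem IsSplit.exists_separated_pow {v : V} (hv : IsSplit p κ v)
    (hσ : ∀ a b, (κ * σ).SameCycle a b) (z : A) (P : ℕ → Prop) {i j : ℕ}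
    (hi : i < Fintype.card A) (hj : j < Fintype.card A) (hi' : p (((κ * σ) ^ i) z) = v)
    (hj' : p (((κ * σ) ^ j) z) = v) (hPi : P i) (hPj : ¬ P j) :
    ∃ x < Fintype.card A, ∃ y < Fintype.card A, p (((κ * σ) ^ x) z) = v ∧
      p (((κ * σ) ^ y) z) = v ∧ P x ∧ ¬ P y ∧
      ¬ κ.SameCycle (((κ * σ) ^ x) z) (((κ * σ) ^ y) z) := by
  obtain ⟨x, y, hx, hy, ⟨m, hm, hPm, rfl⟩, hSy, hxy⟩ := hv.exists_separated
    (fun a => ∃ m < Fintype.card A, P m ∧ ((κ * σ) ^ m) z = a) hi' ⟨i, hi, hPi, rfl⟩ hj' (by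
      rintro ⟨m, hm, hPm, hmj⟩
      rw [pow_injective_of_sameCycle hσ z hm hj hmj] at hPm
      exact hPj hPm)
  obtain ⟨n, hn, rfl⟩ := exists_pow_lt_of_sameCycle hσ z y
  exact ⟨m, hm, n, hn, hx, hy, hPm, fun h => hSy ⟨n, hn, h, rfl⟩, hxy⟩

/-- If `u` and `v` are split and their occurrences along `κ * σ` lie in disjoint segments, then
the occurrences of a vertex within both segments lie in one gap of each. -/
theorem IsOptimal.occurrence (hκ : IsOptimal p σ κ) {u v w : V} (huv : u ≠ v) (hwu : w ≠ u)
    (hwv : w ≠ v) (hu : IsSplit p κ u) (hv : IsSplit p κ v) (z : A) {α β γ : ℕ}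
    (hαβ : α < β) (hγN : γ < Fintype.card A) (hW0 : p z = u)
    (hWα : p (((κ * σ) ^ α) z) = u) (hWβ : p (((κ * σ) ^ β) z) = v)
    (hWγ : p (((κ * σ) ^ γ) z) = v)
    (hu' : ∀ k < Fintype.card A, p (((κ * σ) ^ k) z) = u → k ≤ α)
    {i j k : ℕ} (hi0 : 0 < i) (hiα : i < α) (hjβ : β < j) (hjγ : j < γ)
    (hk : k < Fintype.card A) (hi : p (((κ * σ) ^ i) z) = w) (hj : p (((κ * σ) ^ j) z) = w)
    (hk' : p (((κ * σ) ^ k) z) = w) :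
    (k < α ∧ ∀ m, (i < m ∧ m < k) ∨ (k < m ∧ m < i) → p (((κ * σ) ^ m) z) ≠ u) ∨
    (β < k ∧ k < γ ∧ ∀ m, (j < m ∧ m < k) ∨ (k < m ∧ m < j) → p (((κ * σ) ^ m) z) ≠ v) := by
  have hne : ∀ {k m : ℕ}, p (((κ * σ) ^ k) z) = w → p (((κ * σ) ^ m) z) = u → k ≠ m := by
    rintro k m h1 h2 rfl
    exact hwu (h1.symm.trans h2)
  have hne' : ∀ {k m : ℕ}, p (((κ * σ) ^ k) z) = w → p (((κ * σ) ^ m) z) = v → k ≠ m := by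
    rintro k m h1 h2 rfl
    exact hwv (h1.symm.trans h2)
  have hper : ∀ m, ((κ * σ) ^ (m + Fintype.card A)) z = ((κ * σ) ^ m) z := by
    intro m
    rw [pow_add, pow_card_of_sameCycle hκ.sameCycle, mul_one]
  have hW0' : p (((κ * σ) ^ 0) z) = u := by simpa using hW0
  -- Two occurrences of `u` on either side of `i` and in different orbits of `κ`: with a second `w`
  -- outside, they allow the split to be moved to `w`.
  have hsep : ∃ x y, x < i ∧ i < y ∧ y ≤ α ∧ p (((κ * σ) ^ x) z) = u ∧
      p (((κ * σ) ^ y) z) = u ∧ ¬ κ.SameCycle (((κ * σ) ^ x) z) (((κ * σ) ^ y) z) := by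
    obtain ⟨x, hx, y, hy, hx', hy', hPx, hPy, hxy⟩ := hu.exists_separated_pow hκ.sameCycle z
      (fun m => m < i) (by omega) (by omega) hW0' hWα hi0 (by omega)
    have := hne hi hy'
    exact ⟨x, y, hPx, by omega, hu' y hy hy', hx', hy', hxy⟩
  -- Some `u` between the two `w`'s is in a different orbit from some `u` outside. The side on which
  -- the outer one lies decides which move applies.
  have hinner : ∀ lo m hi : ℕ, 0 < lo → lo < m → m < hi → hi < α →
      p (((κ * σ) ^ lo) z) = w → p (((κ * σ) ^ m) z) = u → p (((κ * σ) ^ hi) z) = w → False := by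
    intro lo m hi h0 h1 h2 h3 hlo hm hhi
    obtain ⟨x, hx, y, hy, hx', hy', hPx, hPy, hxy⟩ := hu.exists_separated_pow hκ.sameCycle z
      (fun m => lo < m ∧ m < hi) (i := m) (j := α) (by omega) (by omega) hm hWα ⟨h1, h2⟩
      (by omega)
    have e1 := hu' y hy hy'
    have e2 := hne hlo hy'
    have e3 := hne hhi hy'
    rcases Nat.lt_or_ge y lo with h4 | h4
    · exact hκ.false_of_move_left huv.symm hwv hv z h4 hPx.1 hPx.2 (show hi < β by omega) hjβ hjγ
        (by omega) hy' hlo hx' hhi hWβ hj hWγ fun h => hxy h.symm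
    -- The window is read from `x`, so the occurrence at `lo` returns at `lo + Fintype.card A`.
    · exact hκ.false_of_move_right huv.symm hwv hv z hPx.2 (show hi < y by omega)
        (show y < β by omega) hjβ hjγ (show γ < lo + Fintype.card A by omega) (by omega)
        hx' hhi hy' hWβ hj hWγ (by rw [hper]; exact hlo) hxy
  have hgap : ∀ lo m hi : ℕ, β < lo → lo < m → m < hi → hi < γ →
      p (((κ * σ) ^ lo) z) = w → p (((κ * σ) ^ m) z) = v → p (((κ * σ) ^ hi) z) = w → False := by
    intro lo m hi' h0 h1 h2 h3 hlo hm hhi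
    obtain ⟨x, y, hxi, hiy, hyα, hx', hy', hxy⟩ := hsep
    exact hκ.false_of_move_left huv.symm hwv hv z hxi hiy (show y < lo by omega) h1 h2 h3
      (by omega) hx' hi hy' hlo hm hhi hWγ hxy
  have k0 := hne hk' hW0'
  have kα := hne hk' hWα
  have kβ := hne' hk' hWβ
  have kγ := hne' hk' hWγ
  rcases Nat.lt_or_ge k α with h | h
  · refine Or.inl ⟨h, ?_⟩
    rintro m (⟨h1, h2⟩ | ⟨h1, h2⟩) hm
    · exact hinner i m k hi0 h1 h2 h hi hm hk'
    · exact hinner k m i (by omega) h1 h2 hiα hk' hm hi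
  right
  -- Occurrences between the segments or after the second one are excluded by the left and the right
  -- move, respectively.
  rcases Nat.lt_or_ge k β with h4 | h4
  · obtain ⟨x, y, hxi, hiy, hyα, hx', hy', hxy⟩ := hsep
    exact (hκ.false_of_move_left huv.symm hwv hv z hxi hiy (show y < k by omega) h4 hjβ hjγ
      (by omega) hx' hi hy' hk' hWβ hj hWγ hxy).elim
  rcases Nat.lt_or_ge γ k with h5 | h5
  · obtain ⟨x, y, hxi, hiy, hyα, hx', hy', hxy⟩ := hsep
    exact (hκ.false_of_move_right huv.symm hwv hv z hxi hiy (show y < β by omega) hjβ hjγ h5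
      (by omega) hx' hi hy' hWβ hj hWγ hk' hxy).elim
  refine ⟨by omega, by omega, ?_⟩
  rintro m (⟨h1, h2⟩ | ⟨h1, h2⟩) hm
  · exact hgap j m k hjβ h1 h2 (by omega) hj hm hk'
  · exact hgap k m j (by omega) h1 h2 hjγ hk' hm hj

theorem IsSplit.exists_lt {v : V} (hv : IsSplit p κ v) (hσ : ∀ a b, (κ * σ).SameCycle a b)
    (z : A) : ∃ m n, m < n ∧ n < Fintype.card A ∧ p (((κ * σ) ^ m) z) = v ∧
      p (((κ * σ) ^ n) z) = v ∧
      ∀ k < Fintype.card A, p (((κ * σ) ^ k) z) = v → m ≤ k ∧ k ≤ n := by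
  classical
  obtain ⟨g, h, hg, hh, hgh⟩ := hv
  obtain ⟨i, hi, rfl⟩ := exists_pow_lt_of_sameCycle hσ z g
  obtain ⟨j, hj, rfl⟩ := exists_pow_lt_of_sameCycle hσ z h
  set T := (Finset.range (Fintype.card A)).filter fun k => p (((κ * σ) ^ k) z) = v with hT
  have hiT : i ∈ T := by simp [hT, hi, hg]
  have hjT : j ∈ T := by simp [hT, hj, hh]
  have hij : i ≠ j := by rintro rfl; exact hgh (SameCycle.refl _ _)
  have hne : T.Nonempty := ⟨i, hiT⟩
  have h1 := Finset.mem_filter.1 (T.min'_mem hne)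
  have h2 := Finset.mem_filter.1 (T.max'_mem hne)
  refine ⟨T.min' hne, T.max' hne, ?_, Finset.mem_range.1 h2.1, h1.2, h2.2, fun k hk hkv => ?_⟩
  · have a1 := T.min'_le i hiT
    have a2 := T.min'_le j hjT
    have a3 := T.le_max' i hiT
    have a4 := T.le_max' j hjT
    omega
  · have hkT : k ∈ T := by simp [hT, hk, hkv]
    exact ⟨T.min'_le k hkT, T.le_max' k hkT⟩

variable [Fintype V]

/-- In a dense graph, at most one vertex is split by an optimal `κ`. -/
theorem IsOptimal.isSplit_unique (hκ : IsOptimal p σ κ) (S : SimpleGraph V) {q : ℕ}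
    (hq : ∀ (a : V) (T : Finset V), (∀ b ∈ T, b ≠ a ∧ ¬ S.Adj a b) → T.card ≤ q)
    (hn : 5 * q + 7 ≤ Fintype.card V)
    (hadj : ∀ u v, S.Adj u v → ∃ a, (p a = u ∧ p (σ a) = v) ∨ (p a = v ∧ p (σ a) = u))
    {u v : V} (hu : IsSplit p κ u) (hv : IsSplit p κ v) : u = v := by
  classical
  by_contra huv
  obtain ⟨z, -, hz, -⟩ := id hv
  set N := Fintype.card A with hN
  have hper : ∀ (z : A) (m : ℕ), ((κ * σ) ^ (m + N)) z = ((κ * σ) ^ m) z := by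
    intro z m
    rw [pow_add, hN, pow_card_of_sameCycle hκ.sameCycle, mul_one]
  obtain ⟨m, n, hmn, hnN, hm, hn', hb⟩ := hu.exists_lt hκ.sameCycle z
  -- Restart the orbit at the first `u` seen from an occurrence `z` of `v`, so that the `u`'s fill
  -- an initial segment.
  set y := ((κ * σ) ^ m) z with hy
  have hshift : ∀ k, ((κ * σ) ^ k) y = ((κ * σ) ^ (m + k)) z := by
    intro k
    rw [hy, add_comm, pow_add, mul_apply]
  have hz0 : p (((κ * σ) ^ N) z) = v := by
    have := hper z 0
    rw [zero_add] at this
    rw [this]; simpa using hz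
  have hu' : ∀ k < N, p (((κ * σ) ^ k) y) = u → k ≤ n - m := by
    intro k hk hku
    rw [hshift] at hku
    rcases Nat.lt_or_ge (m + k) N with h | h
    · have := (hb _ h hku).2
      omega
    · have e : m + k = (m + k - N) + N := by omega
      rw [e, hper] at hku
      have := (hb _ (by omega) hku).1
      omega
  have hWα : p (((κ * σ) ^ (n - m)) y) = u := by
    rw [hshift, show m + (n - m) = n by omega]; exact hn'
  obtain ⟨β, γ, hβγ, hγN, hβ, hγ, hc⟩ := hv.exists_lt hκ.sameCycle y
  -- A `v` between the first and last `u`, together with the return to `z` at time `N`, would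
  -- interlace `u` and `v`.
  have hαβ : n - m < β := by
    by_contra hcon
    have hne : β ≠ n - m := by
      intro h
      rw [h, hWα] at hβ
      exact huv hβ
    have hβ0 : β ≠ 0 := by
      intro h
      rw [h] at hβ
      exact huv (hm.symm.trans (by simpa using hβ))
    have hm0 : m ≠ 0 := by
      rintro rfl
      exact huv (hm.symm.trans (by simpa [hy] using hz))
    refine hκ.not_interlaced_pow huv hu hv z (i := m) (j := m + β) (k := n) (l := N)
      (by omega) (by omega) (by omega) (by omega) hm ?_ hn' hz0
    rw [← hshift]; exact hβ
  refine false_of_word (W := fun k => p (((κ * σ) ^ k) y)) S (N := N) huv hq hn ?_ hαβ hβγ.le hγN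
    ?_ hm hWα hβ hγ hu' hc ?_
  · have hedge : ∀ a, ∃ k < N, ((κ * σ) ^ k) y = a ∧ p (((κ * σ) ^ (k + 1)) y) = p (σ a) := by
      intro a
      obtain ⟨k, hk, hka⟩ := exists_pow_lt_of_sameCycle hκ.sameCycle y a
      exact ⟨k, hk, hka, by rw [pow_succ', mul_apply, hka, mul_apply, hκ.comp]⟩
    intro a b hab
    obtain ⟨c, ⟨h1, h2⟩ | ⟨h1, h2⟩⟩ := hadj a b hab <;> obtain ⟨k, hk, hk1, hk2⟩ := hedge c
    · exact ⟨k, hk, Or.inl ⟨by rw [hk1, h1], by rw [hk2, h2]⟩⟩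
    · exact ⟨k, hk, Or.inr ⟨by rw [hk1, h1], by rw [hk2, h2]⟩⟩
  · have := hper y 0
    rw [zero_add] at this
    simp only [this]
    exact hm
  · intro w hwu hwv i j k hi0 hi1 hj0 hj1 hk hi hj hk'
    exact hκ.occurrence huv hwu hwv hu hv y hαβ hγN hm hWα hβ hγ hu' hi0 hi1 hj0 hj1 hk hi hj hk'

/-- In a dense graph there is a permutation whose orbits are the fibres of `p` and whose product
with `σ` has at most two orbits. -/
theorem exists_orbitCount_le_two (S : SimpleGraph V) {q : ℕ}
    (hq : ∀ (a : V) (T : Finset V), (∀ b ∈ T, b ≠ a ∧ ¬ S.Adj a b) → T.card ≤ q)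
    (hn : 5 * q + 7 ≤ Fintype.card V)
    (hadj : ∀ u v, S.Adj u v → ∃ a, (p a = u ∧ p (σ a) = v) ∨ (p a = v ∧ p (σ a) = u)) :
    ∃ κ : Perm A, (∀ a b, κ.SameCycle a b ↔ p a = p b) ∧
      1 ≤ (κ * σ).orbitCount ∧ (κ * σ).orbitCount ≤ 2 := by
  classical
  have hex : ∃ m, ∃ κ : Perm A, IsUnicursal p σ κ ∧ κ.orbitCount = m := by
    obtain ⟨κ, hκ⟩ := exists_isUnicursal (p := p) (σ := σ) S hq hn hadj
    exact ⟨_, κ, hκ, rfl⟩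
  obtain ⟨κ, hκ', hm⟩ := Nat.find_spec hex
  have hκ : IsOptimal p σ κ :=
    ⟨hκ', fun κ' h => hm.trans_le (Nat.find_min' hex ⟨κ', h, rfl⟩)⟩
  have hone : (κ * σ).orbitCount = 1 := orbitCount_eq_one_iff.2 ⟨inferInstance, hκ.sameCycle⟩
  by_cases hs : ∃ u, IsSplit p κ u
  · obtain ⟨u, x, y, hx, hy, hxy⟩ := hs
    have hu : IsSplit p κ u := ⟨x, y, hx, hy, hxy⟩
    have hne : x ≠ y := by rintro rfl; exact hxy (SameCycle.refl _ _)
    have hcomp := comp_swap_mul hκ.comp (hx.trans hy.symm)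
    -- The only defect of `κ` is the two orbits at `u`. Merging them cuts the single orbit of `κ *
    -- σ` into two.
    refine ⟨swap x y * κ, fun a b => ⟨apply_eq_of_sameCycle hcomp, fun hab => ?_⟩, ?_⟩
    · rw [sameCycle_swap_mul_iff hxy]
      by_cases h : κ.SameCycle a b
      · exact Or.inl h
      · have hau : p a = u := hκ.isSplit_unique S hq hn hadj ⟨a, b, rfl, hab.symm, h⟩ hu
        have h1 := hκ.sameCycle_or (z := a) (hx.trans hy.symm) (hy.trans hau.symm) hxy
        have h2 := hκ.sameCycle_or (z := b) (hx.trans hy.symm)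
          (hy.trans (hau.symm.trans hab)) hxy
        have h3 : ∀ c, κ.SameCycle a c → ¬ κ.SameCycle b c := fun c h1 h2 => h (h1.trans h2.symm)
        have := h3 x
        have := h3 y
        tauto
    · rw [mul_assoc, orbitCount_swap_mul_of_sameCycle (hκ.sameCycle x y) hne, hone]
      omega
  · push Not at hs
    refine ⟨κ, fun a b => ⟨apply_eq_of_sameCycle hκ.comp, fun hab => ?_⟩, hone.ge, by omega⟩
    by_contra h
    exact hs (p b) ⟨a, b, hab, rfl, h⟩

end TransitionSystem

/-! ### Circuits as cycles and the arcs of a decomposition -/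

namespace Cycle

variable {α β : Type*}

theorem Nodup.of_map {f : α → β} {w : Cycle α} (h : (w.map f).Nodup) : w.Nodup := by
  induction w using Quotient.inductionOn with | _ l => ?_
  exact List.Nodup.of_map f h

theorem Nodup.injOn_map {f : α → β} {w : Cycle α} (h : (w.map f).Nodup) {x y : α} (hx : x ∈ w)
    (hy : y ∈ w) (hxy : f x = f y) : x = y := by
  induction w using Quotient.inductionOn with | _ l => ?_
  exact List.inj_on_of_nodup_map h hx hy hxy

theorem exists_mem_of_ne_nil {w : Cycle α} (h : w ≠ nil) : ∃ x, x ∈ w := by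
  induction w using Cycle.induction_on with
  | nil => exact absurd rfl h
  | cons a l _ => exact ⟨a, by simp⟩

theorem chain_iff_next [DecidableEq α] {r : α → α → Prop} {w : Cycle α} (hw : w.Nodup) :
    w.Chain r ↔ ∀ x (hx : x ∈ w), r x (w.next hw x hx) := by
  induction w using Cycle.induction_on with
  | nil => simp
  | cons a l _ =>
    rw [chain_coe_cons, List.isChain_iff_getElem]
    have key : ∀ (i : ℕ) (hi : i < (a :: l).length),
        (a :: (l ++ [a]))[i + 1]'(by simpa using hi) =
          (a :: l)[(i + 1) % (a :: l).length]'(Nat.mod_lt _ (by simp)) := by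
      intro i hi
      rw [List.length_cons] at hi
      rcases Nat.lt_or_ge i l.length with h | h
      · simp only [List.length_cons, Nat.mod_eq_of_lt (show i + 1 < l.length + 1 by omega)]
        simp [List.getElem_append_left, h]
      · have : i = l.length := by omega
        subst this
        simp
    have key' : ∀ (i : ℕ) (hi : i < (a :: l).length),
        (a :: (l ++ [a]))[i]'(by simp at hi ⊢; omega) = (a :: l)[i] := by
      intro i hi
      simp only [← List.cons_append]
      rw [List.getElem_append_left hi]
    constructor
    · intro h x hx
      obtain ⟨i, hi, rfl⟩ := List.getElem_of_mem (mem_coe_iff.1 hx)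
      have := h i (by simpa using hi)
      rw [key i hi, key' i hi] at this
      change r _ (List.next (a :: l) _ (List.getElem_mem hi))
      rwa [List.next_getElem _ hw]
    · intro h i hi
      have hi' : i < (a :: l).length := by simpa using hi
      have := h ((a :: l)[i]) (mem_coe_iff.2 (List.getElem_mem hi'))
      change r _ (List.next (a :: l) _ (List.getElem_mem hi')) at this
      rw [List.next_getElem _ hw] at this
      rwa [key i hi', key' i hi']

/-- Rotating the cycle so that it starts at `x` reduces this to induction along a list. -/
theorem forall_of_next [DecidableEq α] {w : Cycle α} (hw : w.Nodup) {P : α → Prop} {x : α}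
    (hx : x ∈ w) (hPx : P x) (h : ∀ y (hy : y ∈ w), P y → P (w.next hw y hy)) :
    ∀ z ∈ w, P z := by
  induction w using Quotient.inductionOn with | _ l => ?_
  obtain ⟨l₁, l₂, rfl⟩ := List.append_of_mem (mem_coe_iff.1 hx)
  have hr : ((l₁ ++ x :: l₂ : List α) : Cycle α) = ((x :: (l₂ ++ l₁) : List α) : Cycle α) := by
    apply coe_eq_coe.2
    rw [← List.cons_append]
    exact List.isRotated_append
  change ((l₁ ++ x :: l₂ : List α) : Cycle α).Nodup at hw
  change ∀ z ∈ ((l₁ ++ x :: l₂ : List α) : Cycle α), P z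
  change ∀ y (hy : y ∈ ((l₁ ++ x :: l₂ : List α) : Cycle α)), P y → P (next _ hw y hy) at h
  revert hw
  rw [hr]
  intro hw h z hz
  obtain ⟨i, hi, rfl⟩ := List.getElem_of_mem (mem_coe_iff.1 hz)
  clear hz
  induction i with
  | zero => exact hPx
  | succ i ih =>
    have h1 : i < (x :: (l₂ ++ l₁)).length := by omega
    have := h _ (mem_coe_iff.2 (List.getElem_mem h1)) (ih h1)
    change P (List.next (x :: (l₂ ++ l₁)) _ (List.getElem_mem h1)) at this
    rw [List.next_getElem _ hw] at this
    simp only [Nat.mod_eq_of_lt hi] at this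
    exact this

end Cycle

namespace HalfEdgeGraph

open Equiv Equiv.Perm

variable {V H : Type*} {G : HalfEdgeGraph V H}

theorem edge_eq_edge_iff {g h : H} : G.edge g = G.edge h ↔ g = h ∨ g = G.mate h := by
  unfold edge
  rw [Sym2.eq_iff]
  constructor
  · rintro (⟨h1, -⟩ | ⟨h1, -⟩)
    · exact Or.inl h1
    · exact Or.inr h1
  · rintro (rfl | rfl)
    · exact Or.inl ⟨rfl, rfl⟩
    · exact Or.inr ⟨rfl, G.mate_mate h⟩

theorem edge_mate (h : H) : G.edge (G.mate h) = G.edge h := edge_eq_edge_iff.2 (Or.inr rfl)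

theorem mem_reverseWalk {w : Cycle H} {h : H} : h ∈ G.reverseWalk w ↔ G.mate h ∈ w := by
  unfold reverseWalk
  rw [Cycle.mem_reverse_iff, Cycle.mem_map]
  constructor
  · rintro ⟨g, hg, rfl⟩; rwa [G.mate_mate]
  · exact fun hm => ⟨_, hm, G.mate_mate h⟩

theorem IsCircuit.nodup {w : Cycle H} (hw : G.IsCircuit w) : w.Nodup := hw.2.of_map

theorem IsCircuit.mate_notMem {w : Cycle H} (hw : G.IsCircuit w) {h : H} (hh : h ∈ w) :
    G.mate h ∉ w := fun hm => G.mate_ne h (hw.2.injOn_map hm hh (edge_mate h))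

namespace IsCircuitDecomposition

variable {C : Finset (Cycle H)}

theorem eq_of_edge_eq (hC : G.IsCircuitDecomposition C) {w w' : Cycle H} (hw : w ∈ C) (hw' : w' ∈ C) {g g' : H} (hg : g ∈ w)
    (hg' : g' ∈ w') (h : G.edge g = G.edge g') : w = w' :=
  (hC.2 g).unique ⟨hw, g, hg, rfl⟩ ⟨hw', g', hg', h.symm⟩

theorem mem_or (hC : G.IsCircuitDecomposition C) (h : H) : (∃ w ∈ C, h ∈ w) ∨ ∃ w ∈ C, G.mate h ∈ w := by
  obtain ⟨w, ⟨hw, g, hg, hgh⟩, -⟩ := hC.2 h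
  rcases edge_eq_edge_iff.1 hgh with rfl | rfl
  · exact Or.inl ⟨w, hw, hg⟩
  · exact Or.inr ⟨w, hw, hg⟩

theorem not_mem_mate (hC : G.IsCircuitDecomposition C) {h : H} (hh : ∃ w ∈ C, h ∈ w) : ¬ ∃ w ∈ C, G.mate h ∈ w := by
  obtain ⟨w, hw, hm⟩ := hh
  rintro ⟨w', hw', hm'⟩
  obtain rfl := hC.eq_of_edge_eq hw hw' hm hm' (edge_mate h).symm
  exact (hC.1 w hw).mate_notMem hm hm'

end IsCircuitDecomposition

/-- The half-edges through which the walks of `C` leave their vertices. -/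
abbrev Arc (C : Finset (Cycle H)) : Type _ := {h : H // ∃ w ∈ C, h ∈ w}

/-- The walk of `C` to which an arc belongs. -/
noncomputable def Arc.walk {C : Finset (Cycle H)} (a : Arc C) : Cycle H := a.2.choose

theorem Arc.walk_mem {C : Finset (Cycle H)} (a : Arc C) : a.walk ∈ C := a.2.choose_spec.1

theorem Arc.mem_walk {C : Finset (Cycle H)} (a : Arc C) : a.1 ∈ a.walk := a.2.choose_spec.2

namespace IsCircuitDecomposition

variable {C : Finset (Cycle H)}

theorem walk_eq (hC : G.IsCircuitDecomposition C) {w : Cycle H} (hw : w ∈ C) (a : Arc C) (ha : a.1 ∈ w) : a.walk = w :=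
  hC.eq_of_edge_eq a.walk_mem hw a.mem_walk ha rfl

theorem nodup_walk (hC : G.IsCircuitDecomposition C) (a : Arc C) : a.walk.Nodup := (hC.1 _ a.walk_mem).nodup

variable (hC : G.IsCircuitDecomposition C) [DecidableEq H]

/-- The permutation of the arcs that sends each arc to the next arc of its walk. -/
noncomputable def next : Perm (Arc C) where
  toFun a := ⟨a.walk.next (hC.nodup_walk a) a.1 a.mem_walk, a.walk, a.walk_mem, Cycle.next_mem _ _ _ _⟩
  invFun a := ⟨a.walk.prev (hC.nodup_walk a) a.1 a.mem_walk, a.walk, a.walk_mem, Cycle.prev_mem _ _ _ _⟩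
  left_inv a := by
    apply Subtype.ext
    have h := hC.walk_eq a.walk_mem ⟨a.walk.next (hC.nodup_walk a) a.1 a.mem_walk, a.walk,
      a.walk_mem, Cycle.next_mem _ _ _ _⟩ (Cycle.next_mem _ _ _ _)
    simp only [h]
    exact Cycle.prev_next _ _ _ _
  right_inv a := by
    apply Subtype.ext
    have h := hC.walk_eq a.walk_mem ⟨a.walk.prev (hC.nodup_walk a) a.1 a.mem_walk, a.walk,
      a.walk_mem, Cycle.prev_mem _ _ _ _⟩ (Cycle.prev_mem _ _ _ _)
    simp only [h]
    exact Cycle.next_prev _ _ _ _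

theorem coe_next_of_mem {w : Cycle H} (hw : w ∈ C) (a : Arc C) (ha : a.1 ∈ w) :
    (hC.next a).1 = w.next (hC.1 w hw).nodup a.1 ha := by
  have := hC.walk_eq hw a ha
  subst this
  rfl

theorem walk_next (a : Arc C) : (hC.next a).walk = a.walk :=
  hC.walk_eq a.walk_mem _ (Cycle.next_mem _ _ _ _)

theorem inc_next (a : Arc C) : G.inc (hC.next a).1 = G.inc (G.mate a.1) :=
  ((Cycle.chain_iff_next (hC.nodup_walk a)).1 (hC.1 _ a.walk_mem).1.2 a.1 a.mem_walk).symm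

theorem sameCycle_next_iff [Finite H] {a b : Arc C} :
    hC.next.SameCycle a b ↔ a.walk = b.walk := by
  constructor
  · refine SameCycle.of_forall_step (r := fun a b : Arc C => a.walk = b.walk)
      ⟨fun _ => rfl, fun h => h.symm, fun h h' => h.trans h'⟩ fun a => (hC.walk_next a).symm
  · intro h
    refine Cycle.forall_of_next (P := fun z => ∀ hz : ∃ w ∈ C, z ∈ w, hC.next.SameCycle a ⟨z, hz⟩)
      (hC.nodup_walk a) a.mem_walk (fun _ => SameCycle.refl _ _) ?_ b.1 (h ▸ b.mem_walk) b.2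
    intro y hy hPy hz
    refine (hPy ⟨_, a.walk_mem, hy⟩).trans ?_
    have h1 := sameCycle_apply_self hC.next ⟨y, _, a.walk_mem, hy⟩
    have h2 := hC.coe_next_of_mem a.walk_mem ⟨y, _, a.walk_mem, hy⟩ hy
    rwa [show hC.next ⟨y, _, a.walk_mem, hy⟩ = ⟨_, hz⟩ from Subtype.ext h2] at h1

/-- Each edge consists of an arc and its mate. -/
noncomputable def arcSumEquiv : Arc C ⊕ Arc C ≃ H :=
  Equiv.ofBijective (Sum.elim (fun a => a.1) fun a => G.mate a.1) <| by
    have hinj : Function.Injective G.mate := Function.Involutive.injective G.mate_mate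
    constructor
    · rintro (a | a) (b | b) hab <;> simp only [Sum.elim_inl, Sum.elim_inr] at hab
      · rw [Subtype.ext hab]
      · exact absurd (hab ▸ a.2) (hC.not_mem_mate b.2)
      · exact absurd (hab ▸ b.2) (hC.not_mem_mate a.2)
      · rw [Subtype.ext (hinj hab)]
    · intro h
      rcases hC.mem_or h with hh | hh
      · exact ⟨Sum.inl ⟨h, hh⟩, rfl⟩
      · exact ⟨Sum.inr ⟨G.mate h, hh⟩, G.mate_mate h⟩

/-- The permutation of the half-edges that traces the walks of `C` on the arcs, and acts as `τ`
on the mates of the arcs. -/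
noncomputable def extend (τ : Perm (Arc C)) : Perm H :=
  hC.arcSumEquiv.permCongr (Equiv.Perm.sumCongr hC.next τ)

theorem extend_coe (τ : Perm (Arc C)) (a : Arc C) : hC.extend τ a.1 = (hC.next a).1 := by
  have : a.1 = hC.arcSumEquiv (Sum.inl a) := rfl
  rw [this, extend, Equiv.permCongr_apply, Equiv.symm_apply_apply]
  rfl

theorem extend_mate (τ : Perm (Arc C)) (a : Arc C) :
    hC.extend τ (G.mate a.1) = G.mate (τ a).1 := by
  have : G.mate a.1 = hC.arcSumEquiv (Sum.inr a) := rfl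
  rw [this, extend, Equiv.permCongr_apply, Equiv.symm_apply_apply]
  rfl

theorem sameCycle_extend_coe [Finite H] (τ : Perm (Arc C)) {a b : Arc C} :
    (hC.extend τ).SameCycle a.1 b.1 ↔ hC.next.SameCycle a b := by
  have key : ∀ n : ℕ, ((hC.extend τ) ^ n) a.1 = ((hC.next ^ n) a).1 := by
    intro n
    induction n with
    | zero => rfl
    | succ n ih => rw [pow_succ', mul_apply, ih, extend_coe, pow_succ', mul_apply]
  constructor
  · intro h
    obtain ⟨n, -, -, hn⟩ := h.exists_pow_eq''
    exact ⟨n, Subtype.ext (by rw [zpow_natCast, ← key, hn])⟩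
  · intro h
    obtain ⟨n, -, -, hn⟩ := h.exists_pow_eq''
    exact ⟨n, by rw [zpow_natCast, key, hn]⟩

theorem sameCycle_extend_mate [Finite H] (τ : Perm (Arc C)) {a b : Arc C} :
    (hC.extend τ).SameCycle (G.mate a.1) (G.mate b.1) ↔ τ.SameCycle a b := by
  have key : ∀ n : ℕ, ((hC.extend τ) ^ n) (G.mate a.1) = G.mate ((τ ^ n) a).1 := by
    intro n
    induction n with
    | zero => rfl
    | succ n ih => rw [pow_succ', mul_apply, ih, extend_mate, pow_succ', mul_apply]
  have hinj : Function.Injective G.mate := Function.Involutive.injective G.mate_mate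
  constructor
  · intro h
    obtain ⟨n, -, -, hn⟩ := h.exists_pow_eq''
    exact ⟨n, Subtype.ext (hinj (by rw [zpow_natCast, ← key, hn]))⟩
  · intro h
    obtain ⟨n, -, -, hn⟩ := h.exists_pow_eq''
    exact ⟨n, by rw [zpow_natCast, key, hn]⟩

/-- Arcs are sent to arcs and mates of arcs to mates of arcs; hence each face is of one kind, which
gives the 2-coloring. -/
theorem mem_arc_iff_of_sameCycle [Finite H] (τ : Perm (Arc C)) {g h : H}
    (hgh : (hC.extend τ).SameCycle g h) : (∃ w ∈ C, g ∈ w) ↔ ∃ w ∈ C, h ∈ w := by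
  refine hgh.of_forall_step (r := fun g h : H => (∃ w ∈ C, g ∈ w) ↔ ∃ w ∈ C, h ∈ w)
    ⟨fun _ => Iff.rfl, fun h => h.symm, fun h h' => h.trans h'⟩ fun h => ?_
  by_cases hh : ∃ w ∈ C, h ∈ w
  · have := hC.extend_coe τ ⟨h, hh⟩
    rw [this]
    exact iff_of_true hh (hC.next ⟨h, hh⟩).2
  · have hm : ∃ w ∈ C, G.mate h ∈ w := (hC.mem_or h).resolve_left hh
    have := hC.extend_mate τ ⟨G.mate h, hm⟩
    rw [G.mate_mate] at this
    rw [this]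
    exact iff_of_false hh (hC.not_mem_mate (τ _).2)

end IsCircuitDecomposition

end HalfEdgeGraph

/-! ### Face counts, parity and the embedding built from `κ` -/

namespace HalfEdgeGraph

open Equiv Equiv.Perm

variable {V H : Type*} {G : HalfEdgeGraph V H}

theorem matePerm_apply (h : H) : G.matePerm h = G.mate h := rfl

theorem matePerm_mul_self : G.matePerm * G.matePerm = 1 := by
  ext h
  exact G.mate_mate h

namespace OrientedEmbedding

variable (Ψ : G.OrientedEmbedding)

theorem faceOf_eq_iff {g h : H} : Ψ.faceOf g = Ψ.faceOf h ↔ Ψ.facePerm.SameCycle g h :=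
  Quotient.eq

theorem orbitCount_rot (hinc : Function.Surjective G.inc) : Ψ.rot.orbitCount = Nat.card V := by
  refine Nat.card_eq_of_bijective (Quotient.lift G.inc fun g h hgh => (Ψ.sameCycle_iff g h).1 hgh)
    ⟨fun q r => ?_, fun v => ?_⟩
  · induction q using Quotient.inductionOn with | _ g => ?_
    induction r using Quotient.inductionOn with | _ h => ?_
    exact fun hgh => Quotient.sound ((Ψ.sameCycle_iff g h).2 hgh)
  · obtain ⟨h, rfl⟩ := hinc v
    exact ⟨Quotient.mk _ h, rfl⟩

theorem IsBoundedBy.mem {Ψ : G.OrientedEmbedding} {f : Ψ.Face} {w : Cycle H}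
    (hf : Ψ.IsBoundedBy f w) {h : H} (hh : Ψ.faceOf h = f) : h ∈ w ∨ G.mate h ∈ w :=
  hf.imp (fun ht => (ht.2.2 h).2 hh) fun ht => mem_reverseWalk.1 ((ht.2.2 h).2 hh)

theorem genus_le_genus {Ψ Φ : G.OrientedEmbedding} (h : Nat.card Φ.Face ≤ Nat.card Ψ.Face) :
    Ψ.genus ≤ Φ.genus := by
  unfold genus
  have : (Nat.card Φ.Face : ℚ) ≤ (Nat.card Ψ.Face : ℚ) := by exact_mod_cast h
  linarith

end OrientedEmbedding

variable [Finite H]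

theorem orbitCount_matePerm : G.matePerm.orbitCount = Nat.card G.Edge := by
  have hrel : ∀ {g h : H}, G.matePerm.SameCycle g h ↔ G.edge g = G.edge h := by
    intro g h
    constructor
    · exact SameCycle.of_forall_step (r := fun g h => G.edge g = G.edge h)
        ⟨fun _ => rfl, fun h => h.symm, fun h h' => h.trans h'⟩ fun a => (edge_mate a).symm
    · intro hgh
      rcases edge_eq_edge_iff.1 hgh with rfl | rfl
      · exact SameCycle.refl _ _
      · exact (sameCycle_apply_self G.matePerm h).symm
  refine Nat.card_eq_of_bijective (Quotient.lift (fun h => (⟨G.edge h, h, rfl⟩ : G.Edge))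
    fun g h hgh => Subtype.ext (hrel.1 hgh)) ⟨fun q r => ?_, ?_⟩
  · induction q using Quotient.inductionOn with | _ g => ?_
    induction r using Quotient.inductionOn with | _ h => ?_
    exact fun hgh => Quotient.sound (hrel.2 (Subtype.ext_iff.1 hgh))
  · rintro ⟨e, h, rfl⟩
    exact ⟨Quotient.mk _ h, rfl⟩

namespace OrientedEmbedding

variable (Ψ : G.OrientedEmbedding)

/-- The Euler characteristic of an oriented embedding is even. -/
theorem even_card_add_card_add_card (hinc : Function.Surjective G.inc) (hH : Even (Nat.card H)) :
    Even (Nat.card V + Nat.card G.Edge + Nat.card Ψ.Face) := by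
  classical
  have := Fintype.ofFinite H
  have h1 := neg_one_pow_orbitCount Ψ.rot
  have h2 := neg_one_pow_orbitCount G.matePerm
  have h3 := neg_one_pow_orbitCount Ψ.facePerm
  rw [Ψ.orbitCount_rot hinc] at h1
  rw [orbitCount_matePerm] at h2
  rw [Nat.card_eq_fintype_card] at hH
  rw [hH.neg_one_pow, one_mul] at h1 h2 h3
  have h4 : (-1 : ℤˣ) ^ (Nat.card V + Nat.card G.Edge + Nat.card Ψ.Face) = 1 := by
    rw [pow_add, pow_add, h1, h2]
    change _ * (-1 : ℤˣ) ^ Ψ.facePerm.orbitCount = 1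
    -- The sign of `facePerm` is the product of the other two signs, so everything is squared.
    rw [h3, facePerm, Perm.sign_mul, ← sq, Int.units_sq]
  rcases Nat.even_or_odd (Nat.card V + Nat.card G.Edge + Nat.card Ψ.Face) with h | h
  · exact h
  · rw [h.neg_one_pow] at h4
    exact absurd h4 (by decide)

/-- An embedding with the circuits of a decomposition among its faces has a further face. -/
theorem card_lt_card_face [Nonempty H] {C : Finset (Cycle H)} (hC : G.IsCircuitDecomposition C)
    (hΨ : ∀ w ∈ C, ∃ f : Ψ.Face, Ψ.IsBoundedBy f w) : C.card < Nat.card Ψ.Face := by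
  classical
  have : Nonempty Ψ.Face := ‹Nonempty H›.map Ψ.faceOf
  choose! f hf using hΨ
  have := Fintype.ofFinite Ψ.Face
  have hedge : ∀ {w : Cycle H}, w ∈ C → ∀ {h : H}, Ψ.faceOf h = f w →
      ∃ g ∈ w, G.edge g = G.edge h := by
    intro w hw h hh
    rcases (hf w hw).mem hh with hm | hm
    · exact ⟨h, hm, rfl⟩
    · exact ⟨_, hm, edge_mate h⟩
  have hinj : Set.InjOn f C := by
    intro w hw w' hw' hww
    obtain ⟨h, hh⟩ : ∃ h, Ψ.faceOf h = f w := Quotient.exists_rep (f w)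
    obtain ⟨g, hg, hgh⟩ := hedge hw hh
    obtain ⟨g', hg', hgh'⟩ := hedge hw' (hh.trans hww)
    exact hC.eq_of_edge_eq hw hw' hg hg' (hgh.trans hgh'.symm)
  -- If no face were left, both sides of an edge would lie on faces given by the same circuit, hence
  -- on one face, whose trace would use that edge twice.
  have hsurj : ∃ f₀, f₀ ∉ C.image f := by
    by_contra hcon
    push Not at hcon
    obtain ⟨h⟩ := ‹Nonempty H›
    obtain ⟨w, hw, hwf⟩ := Finset.mem_image.1 (hcon (Ψ.faceOf h))
    obtain ⟨w', hw', hwf'⟩ := Finset.mem_image.1 (hcon (Ψ.faceOf (G.mate h)))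
    obtain ⟨g, hg, hgh⟩ := hedge hw hwf.symm
    obtain ⟨g', hg', hgh'⟩ := hedge hw' hwf'.symm
    obtain rfl := hC.eq_of_edge_eq hw hw' hg hg' (hgh.trans ((edge_mate h).symm.trans hgh'.symm))
    rcases hf w hw with ht | ht
    · exact (hC.1 w hw).mate_notMem ((ht.2.2 h).2 hwf.symm) ((ht.2.2 _).2 hwf'.symm)
    · have h1 := mem_reverseWalk.1 ((ht.2.2 h).2 hwf.symm)
      have h2 := mem_reverseWalk.1 ((ht.2.2 _).2 hwf'.symm)
      exact (hC.1 w hw).mate_notMem h1 h2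
  obtain ⟨f₀, hf₀⟩ := hsurj
  rw [Nat.card_eq_fintype_card, ← Finset.card_image_of_injOn hinj]
  exact Finset.card_lt_univ_of_notMem hf₀

end OrientedEmbedding

namespace IsCircuitDecomposition

variable {C : Finset (Cycle H)} (hC : G.IsCircuitDecomposition C) [DecidableEq H]
  (κ : Perm (Arc C)) (hκ : ∀ a b : Arc C, κ.SameCycle a b ↔ G.inc a.1 = G.inc b.1)

/-- The embedding whose faces are the walks of `C` and the reversed orbits of `κ * hC.next`. -/
noncomputable def embedding : G.OrientedEmbedding where
  rot := hC.extend (κ * hC.next)⁻¹ * G.matePerm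
  sameCycle_iff := by
    have hmate : ∀ a : Arc C, (hC.extend (κ * hC.next)⁻¹ * G.matePerm) (G.mate a.1) =
        (hC.next a).1 := fun a => by
      rw [mul_apply, matePerm_apply, G.mate_mate, hC.extend_coe]
    have hcoe : ∀ a : Arc C, (hC.extend (κ * hC.next)⁻¹ * G.matePerm) a.1 =
        G.mate ((κ * hC.next)⁻¹ a).1 := fun a => by
      rw [mul_apply, matePerm_apply, hC.extend_mate]
    -- The rotation alternates between arcs and mates of arcs, and two steps from an arc `a` lead to
    -- `κ⁻¹ a`. So its orbits on arcs are those of `κ`.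
    have hnext : ∀ a : Arc C, hC.next ((κ * hC.next)⁻¹ a) = κ⁻¹ a := fun a => by
      rw [mul_inv_rev, mul_apply, ← mul_apply, mul_inv_cancel, one_apply]
    intro g h
    constructor
    · refine SameCycle.of_forall_step (r := fun g h => G.inc g = G.inc h)
        ⟨fun _ => rfl, fun h => h.symm, fun h h' => h.trans h'⟩ fun h => ?_
      rcases hC.mem_or h with hh | hh
      · rw [hcoe ⟨h, hh⟩, ← hC.inc_next, hnext]
        exact (hκ ⟨h, hh⟩ _).1 ⟨-1, by rw [zpow_neg_one]⟩
      · have := hmate ⟨G.mate h, hh⟩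
        rw [G.mate_mate] at this
        rw [this, hC.inc_next, G.mate_mate]
    · have key : ∀ a b : Arc C, G.inc a.1 = G.inc b.1 →
          (hC.extend (κ * hC.next)⁻¹ * G.matePerm).SameCycle a.1 b.1 := by
        intro a b hab
        refine (sameCycle_inv.2 ((hκ a b).2 hab)).of_forall_step
          (r := fun a b : Arc C => (hC.extend (κ * hC.next)⁻¹ * G.matePerm).SameCycle a.1 b.1)
          ⟨fun _ => SameCycle.refl _ _, fun h => h.symm, fun h h' => h.trans h'⟩ fun c => ?_
        have h1 := sameCycle_apply_self (hC.extend (κ * hC.next)⁻¹ * G.matePerm) c.1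
        have h2 := sameCycle_apply_self (hC.extend (κ * hC.next)⁻¹ * G.matePerm)
          (G.mate ((κ * hC.next)⁻¹ c).1)
        rw [hcoe] at h1
        rw [hmate, hnext] at h2
        exact h1.trans h2
      -- The mate of an arc is followed in the rotation by an arc at the same vertex, which reduces
      -- the claim to arcs.
      have harc : ∀ h : H, ∃ a : Arc C, G.inc a.1 = G.inc h ∧
          (hC.extend (κ * hC.next)⁻¹ * G.matePerm).SameCycle h a.1 := by
        intro h
        rcases hC.mem_or h with hh | hh
        · exact ⟨⟨h, hh⟩, rfl, SameCycle.refl _ _⟩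
        · refine ⟨hC.next ⟨G.mate h, hh⟩, by rw [hC.inc_next, G.mate_mate], ?_⟩
          have h1 := sameCycle_apply_self (hC.extend (κ * hC.next)⁻¹ * G.matePerm) h
          have h2 := hmate ⟨G.mate h, hh⟩
          rw [G.mate_mate] at h2
          rwa [h2] at h1
      intro hgh
      obtain ⟨a, ha, hga⟩ := harc g
      obtain ⟨b, hb, hhb⟩ := harc h
      exact hga.trans ((key a b (ha.trans (hgh.trans hb.symm))).trans hhb.symm)

theorem facePerm_embedding : (hC.embedding κ hκ).facePerm = hC.extend (κ * hC.next)⁻¹ := by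
  unfold OrientedEmbedding.facePerm embedding
  rw [mul_assoc, matePerm_mul_self, mul_one]

open Classical in
/-- The coloring of the faces that distinguishes the walks of `C`. -/
noncomputable def color (f : (hC.embedding κ hκ).Face) : Bool :=
  decide (∃ a : Arc C, (hC.embedding κ hκ).faceOf a.1 = f)

theorem color_faceOf {h : H} :
    hC.color κ hκ ((hC.embedding κ hκ).faceOf h) = true ↔ ∃ w ∈ C, h ∈ w := by
  rw [color, @decide_eq_true_iff]
  constructor
  · rintro ⟨a, ha⟩
    rw [OrientedEmbedding.faceOf_eq_iff, facePerm_embedding] at ha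
    exact (hC.mem_arc_iff_of_sameCycle _ ha).1 a.2
  · exact fun hh => ⟨⟨h, hh⟩, rfl⟩

theorem isTwoFaceColoring_color :
    (hC.embedding κ hκ).IsTwoFaceColoring (hC.color κ hκ) := by
  intro h heq
  have h1 := hC.color_faceOf κ hκ (h := h)
  have h2 := hC.color_faceOf κ hκ (h := G.mate h)
  rw [heq] at h1
  rcases hC.mem_or h with hh | hh
  · exact hC.not_mem_mate hh (h2.1 (h1.2 hh))
  · exact hC.not_mem_mate (h1.1 (h2.2 hh)) hh

theorem faceOf_coe_eq_iff {a b : Arc C} : (hC.embedding κ hκ).faceOf a.1 =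
    (hC.embedding κ hκ).faceOf b.1 ↔ a.walk = b.walk := by
  rw [OrientedEmbedding.faceOf_eq_iff, facePerm_embedding, hC.sameCycle_extend_coe,
    hC.sameCycle_next_iff]

theorem isBoundedBy_walk (a : Arc C) :
    (hC.embedding κ hκ).IsBoundedBy ((hC.embedding κ hκ).faceOf a.1) a.walk := by
  refine Or.inl ⟨hC.nodup_walk a, (Cycle.chain_iff_next (hC.nodup_walk a)).2 fun x hx => ?_,
    fun h => ⟨fun hh => ?_, fun hh => ?_⟩⟩
  · have := hC.extend_coe (κ * hC.next)⁻¹ ⟨x, _, a.walk_mem, hx⟩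
    rw [facePerm_embedding, this, hC.coe_next_of_mem a.walk_mem _ hx]
  · exact (hC.faceOf_coe_eq_iff κ hκ (a := ⟨h, _, a.walk_mem, hh⟩)).2
      (hC.walk_eq a.walk_mem _ hh)
  · have hm : ∃ w ∈ C, h ∈ w := by
      rw [← hC.color_faceOf κ hκ, hh, hC.color_faceOf κ hκ]
      exact a.2
    rw [← (hC.faceOf_coe_eq_iff κ hκ (a := ⟨h, hm⟩)).1 hh]
    exact Arc.mem_walk (⟨h, hm⟩ : Arc C)

/-- The faces of the first color correspond to the walks of `C`. -/
theorem exists_equiv_face : ∃ e : {w : Cycle H // w ∈ C} ≃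
    {f : (hC.embedding κ hκ).Face // hC.color κ hκ f = true},
    ∀ w : {w : Cycle H // w ∈ C}, (hC.embedding κ hκ).IsBoundedBy (e w).1 w.1 := by
  have hex : ∀ w : {w : Cycle H // w ∈ C}, ∃ a : Arc C, a.walk = w.1 := by
    intro w
    obtain ⟨x, hx⟩ := Cycle.exists_mem_of_ne_nil (hC.1 w.1 w.2).1.1
    exact ⟨⟨x, w.1, w.2, hx⟩, hC.walk_eq w.2 _ hx⟩
  choose a ha using hex
  let e : {w : Cycle H // w ∈ C} → {f : (hC.embedding κ hκ).Face // hC.color κ hκ f = true} :=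
    fun w => ⟨(hC.embedding κ hκ).faceOf (a w).1, (hC.color_faceOf κ hκ).2 (a w).2⟩
  have he : Function.Bijective e := by
    constructor
    · intro w w' hww
      have := (hC.faceOf_coe_eq_iff κ hκ).1 (Subtype.ext_iff.1 hww)
      rw [ha, ha] at this
      exact Subtype.ext this
    · rintro ⟨f, hf⟩
      obtain ⟨h, rfl⟩ : ∃ h, (hC.embedding κ hκ).faceOf h = f := Quotient.exists_rep f
      have hh := (hC.color_faceOf κ hκ).1 hf
      refine ⟨⟨Arc.walk (⟨h, hh⟩ : Arc C), Arc.walk_mem _⟩, Subtype.ext ?_⟩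
      exact (hC.faceOf_coe_eq_iff κ hκ (b := ⟨h, hh⟩)).2 (ha _)
  refine ⟨Equiv.ofBijective e he, fun w => ?_⟩
  have := hC.isBoundedBy_walk κ hκ (a w)
  rwa [ha] at this

theorem card_color_false : Nat.card {f : (hC.embedding κ hκ).Face // hC.color κ hκ f = false} =
    (κ * hC.next).orbitCount := by
  have hrel : ∀ {a b : Arc C}, (hC.embedding κ hκ).faceOf (G.mate a.1) =
      (hC.embedding κ hκ).faceOf (G.mate b.1) ↔ (κ * hC.next).SameCycle a b := by
    intro a b
    rw [OrientedEmbedding.faceOf_eq_iff, facePerm_embedding, hC.sameCycle_extend_mate,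
      sameCycle_inv]
  have hcol : ∀ a : Arc C,
      hC.color κ hκ ((hC.embedding κ hκ).faceOf (G.mate a.1)) = false := fun a => by
    rw [← Bool.not_eq_true, hC.color_faceOf κ hκ]
    exact hC.not_mem_mate a.2
  symm
  refine Nat.card_eq_of_bijective (Quotient.lift (fun a : Arc C =>
    (⟨(hC.embedding κ hκ).faceOf (G.mate a.1), hcol a⟩ :
      {f : (hC.embedding κ hκ).Face // hC.color κ hκ f = false}))
    fun a b hab => Subtype.ext (hrel.2 hab)) ⟨fun q r => ?_, ?_⟩
  · induction q using Quotient.inductionOn with | _ a => ?_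
    induction r using Quotient.inductionOn with | _ b => ?_
    exact fun hab => Quotient.sound (hrel.1 (Subtype.ext_iff.1 hab))
  · rintro ⟨f, hf⟩
    obtain ⟨h, rfl⟩ : ∃ h, (hC.embedding κ hκ).faceOf h = f := Quotient.exists_rep f
    rw [← Bool.not_eq_true, hC.color_faceOf κ hκ] at hf
    have hm := (hC.mem_or h).resolve_left hf
    exact ⟨Quotient.mk _ ⟨G.mate h, hm⟩, Subtype.ext
      (congrArg (hC.embedding κ hκ).faceOf (G.mate_mate h))⟩

theorem card_face_embedding : Nat.card (hC.embedding κ hκ).Face =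
    C.card + (κ * hC.next).orbitCount := by
  obtain ⟨e, -⟩ := hC.exists_equiv_face κ hκ
  have h1 : Nat.card {f // hC.color κ hκ f = true} = C.card := by
    rw [← Nat.card_congr e, Nat.card_eq_fintype_card, Fintype.card_coe]
  rw [← hC.card_color_false κ hκ, ← h1, ← Nat.card_sum]
  refine Nat.card_congr ((Equiv.sumCompl fun f => hC.color κ hκ f = true).symm.trans
    (Equiv.sumCongr (Equiv.refl _) (Equiv.subtypeEquivRight fun f => ?_)))
  rw [Bool.not_eq_true]

end IsCircuitDecomposition

end HalfEdgeGraph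

/-! ### The degree condition and the main theorem -/

theorem SimpleGraph.card_add_minDegree_lt {V : Type*} [Fintype V] (S : SimpleGraph V)
    [DecidableRel S.Adj] (a : V) (T : Finset V) (hT : ∀ b ∈ T, b ≠ a ∧ ¬ S.Adj a b) :
    T.card + S.minDegree < Fintype.card V := by
  classical
  have h1 : Disjoint T (S.neighborFinset a) := Finset.disjoint_left.2 fun b hb hb' =>
    (hT b hb).2 ((S.mem_neighborFinset a b).1 hb')
  have h2 : a ∉ T ∪ S.neighborFinset a := by
    rw [Finset.mem_union, S.mem_neighborFinset]
    rintro (h | h)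
    · exact (hT a h).1 rfl
    · exact S.irrefl h
  have h3 := Finset.card_lt_univ_of_notMem h2
  rw [Finset.card_union_of_disjoint h1, S.card_neighborFinset_eq_degree] at h3
  have h4 := S.minDegree_le_degree a
  omega

open HalfEdgeGraph Equiv.Perm in
theorem corollary4p4 {V H : Type*} [Fintype V] [Finite H] (G : HalfEdgeGraph V H)
    [DecidableRel G.simpleGraph.Adj] (hG : G.IsEulerian)
    (hdeg : (4 * (Fintype.card V : ℚ) + 2) / 5 ≤ (G.simpleGraph.minDegree : ℚ))
    (C : Finset (Cycle H)) (hC : G.IsCircuitDecomposition C) :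
    ∃ (Φ : G.OrientedEmbedding) (col : Φ.Face → Bool),
      Φ.IsTwoFaceColoring col ∧
      (∃ e : {w : Cycle H // w ∈ C} ≃ {f : Φ.Face // col f = true},
        ∀ w : {w : Cycle H // w ∈ C}, Φ.IsBoundedBy (e w).1 w.1) ∧
      (Odd (Fintype.card V + Nat.card G.Edge + C.card) →
        Nat.card {f : Φ.Face // col f = false} = 1) ∧
      (Even (Fintype.card V + Nat.card G.Edge + C.card) →
        Nat.card {f : Φ.Face // col f = false} = 2) ∧
      ∀ Ψ : G.OrientedEmbedding, (∀ w ∈ C, ∃ f : Ψ.Face, Ψ.IsBoundedBy f w) →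
        Ψ.genus ≤ Φ.genus := by
  classical
  have hdeg' : 4 * Fintype.card V + 2 ≤ 5 * G.simpleGraph.minDegree := by
    rw [div_le_iff₀ (by norm_num)] at hdeg
    have : ((4 * Fintype.card V + 2 : ℕ) : ℚ) ≤ ((5 * G.simpleGraph.minDegree : ℕ) : ℚ) := by
      push_cast
      linarith
    exact_mod_cast this
  have hV : Nonempty V := by
    rcases hG with ⟨w, ⟨⟨hw, -⟩, -⟩, -⟩ | ⟨h, -⟩
    · obtain ⟨x, -⟩ := Cycle.exists_mem_of_ne_nil hw
      exact ⟨G.inc x⟩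
    · exact h
  obtain ⟨v₀⟩ := id hV
  have hlt := G.simpleGraph.card_add_minDegree_lt v₀ ∅ (by simp)
  rw [Finset.card_empty, zero_add] at hlt
  have hadj : ∀ u v, G.simpleGraph.Adj u v → ∃ a : Arc C,
      (G.inc a.1 = u ∧ G.inc (hC.next a).1 = v) ∨ (G.inc a.1 = v ∧ G.inc (hC.next a).1 = u) := by
    rintro u v ⟨-, h, rfl, rfl⟩
    rcases hC.mem_or h with hh | hh
    · exact ⟨⟨h, hh⟩, Or.inl ⟨rfl, hC.inc_next _⟩⟩
    · exact ⟨⟨_, hh⟩, Or.inr ⟨rfl, by rw [hC.inc_next, G.mate_mate]⟩⟩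
  have hsurj : ∀ v, ∃ a : Arc C, G.inc a.1 = v := by
    intro v
    have h1 := G.simpleGraph.minDegree_le_degree v
    obtain ⟨w, hw⟩ := (G.simpleGraph.degree_pos_iff_exists_adj v).1 (by omega)
    obtain ⟨a, h | h⟩ := hadj v w hw
    · exact ⟨a, h.1⟩
    · exact ⟨_, h.2⟩
  have hinc : Function.Surjective G.inc := fun v => let ⟨a, ha⟩ := hsurj v; ⟨a.1, ha⟩
  have : Nontrivial (Arc C) := by
    have : Nontrivial V := Fintype.one_lt_card_iff_nontrivial.1 (by omega)
    obtain ⟨u, v, huv⟩ := exists_pair_ne V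
    obtain ⟨a, rfl⟩ := hsurj u
    obtain ⟨b, rfl⟩ := hsurj v
    exact ⟨a, b, fun h => huv (h ▸ rfl)⟩
  have : Nonempty H := let ⟨a, _⟩ := hinc v₀; ⟨a⟩
  have := Fintype.ofFinite (Arc C)
  -- Each vertex has at most `q = n - 1 - δ` non-neighbours, and `5δ ≥ 4n + 2` turns into `n ≥ 5q +
  -- 7`.
  obtain ⟨κ, hκ, h1, h2⟩ := TransitionSystem.exists_orbitCount_le_two
    (p := fun a : Arc C => G.inc a.1) (σ := hC.next) G.simpleGraph
    (q := Fintype.card V - 1 - G.simpleGraph.minDegree)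
    (fun a T hT => by have := G.simpleGraph.card_add_minDegree_lt a T hT; omega) (by omega) hadj
  have hH : Even (Nat.card H) := by
    rw [← Nat.card_congr hC.arcSumEquiv, Nat.card_sum]
    exact ⟨_, rfl⟩
  have hface := hC.card_face_embedding κ hκ
  have hpar := fun Ψ : G.OrientedEmbedding => Ψ.even_card_add_card_add_card hinc hH
  simp only [Nat.card_eq_fintype_card (α := V)] at hpar
  have hΦ := hpar (hC.embedding κ hκ)
  refine ⟨hC.embedding κ hκ, hC.color κ hκ, hC.isTwoFaceColoring_color κ hκ,
    hC.exists_equiv_face κ hκ, fun hodd => ?_, fun heven => ?_, fun Ψ hΨ => ?_⟩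
  -- Here `|V| + |E| + |C|` plus the number of remaining faces, which is 1 or 2, is even.
  · rw [hC.card_color_false κ hκ]
    rw [hface] at hΦ
    rw [Nat.odd_iff] at hodd
    rw [Nat.even_iff] at hΦ
    omega
  · rw [hC.card_color_false κ hκ]
    rw [hface] at hΦ
    rw [Nat.even_iff] at heven hΦ
    omega
  -- `Ψ` has at least `|C| + 1` faces, and their number has the same parity as that of the
  -- constructed embedding, which is at most `|C| + 2`.
  · have h3 := Ψ.card_lt_card_face hC hΨ
    have h4 := hpar Ψ
    refine OrientedEmbedding.genus_le_genus ?_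
    rw [hface] at hΦ ⊢
    rw [Nat.even_iff] at hΦ h4
    omega
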